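/- **Setting.** Let $F:\mathbb R^d\to\mathbb R^d$ be Borel measurable, and suppose there are $\lambda\ge 0$, $\mu>0$ and a point $x^*$ with $F(x^*)=0$ such that $\langle F(x),x-x^*\rangle\ge\mu\|x-x^*\|^2-\lambda$ for all $x\in\mathbb R^d$. Let $U_0,U_1,\dots$ be i.i.d. random fields on $\mathbb R^d$, that is, $U_k(x)=U(x,\xi_k)$ with $U$ jointly measurable and $(\xi_k)_{k\ge 0}$ i.i.d., such that $\mathbb E[U_k(x)]=0$ and $\mathbb E\|U_k(x)\|^2\le\sigma^2$ for all $x$. Suppose further that $U_k(x)=U_k^a(x)+U_k^b(x)$ for every $k$ and $x$, where $U_k^a(x)$ and $U_k^b(x)$ are independent and $U_k^a(x)$ has a Lebesgue density $p_x$ (not depending on $k$), with $\inf_{x\in C,\,t\in T}p_x(t)>0$ for all bounded sets $C,T\subseteq\mathbb R^d$. Let $X_0$ be independent of $(\xi_k)_k$, for instance a fixed point. Consider the following two algorithms. * **SGDA:** $X_{n+1}=X_n-\gamma\,(F(X_n)+U_n(X_n))$, where $\|F(x)\|\le\ell(1+\|x\|)$ for all $x$ and $0<\gamma<\mu/\ell^2$.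 * **SEG:** $X_{n+1/2}=X_n-\gamma\,(F(X_n)+U_{2n}(X_n))$ and $X_{n+1}=X_n-\alpha\gamma\,(F(X_{n+1/2})+U_{2n+1}(X_{n+1/2}))$, where $F$ is $L$-Lipschitz, $0<\gamma<1/(2\mu+\sqrt3L)$ and $0<\alpha<1$. **Claim.** In each of the two cases there is a Markov kernel $P$ on $\mathbb R^d$ (not depending on $X_0$) such that $(X_n)_{n\ge0}$ is a time-homogeneous Markov chain with transition kernel $P$ and initial distribution $\mathrm{law}(X_0)$, and there is a non-zero $\sigma$-finite Borel measure $\psi$ on $\mathbb R^d$ such that: 1. The chain is $\psi$-irreducible: for every $x$ and every Borel set $A$ with $\psi(A)>0$ there is $n\ge1$ with $P^n(x,A)>0$; moreover $\psi$ is maximal, i.e. every measure with this property is absolutely continuous with respect to $\psi$. 2. The chain is strongly aperiodic: there are a Borel set $A$ and a measure $\nu$ with $\nu(A)>0$ and $P(x,B)\ge\nu(B)$ for all $x\in A$ and all Borel sets $B$. 3. The chain is Harris recurrent: for every Borel set $A$ with $\psi(A)>0$ and every $x\in A$, the chain with kernel $P$ started at $x$ almost surely visits $A$ infinitely often. It is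 also positive recurrent: for every such $A$ and $x$, $\limsup_{n\to\infty}P^n(x,A)>0$. And $P$ has an invariant probability measure. -/

import Mathlib

open MeasureTheory ProbabilityTheory Filter Topology
open scoped ENNReal NNReal

noncomputable section

/-! ### Operators -/

/-- `F` is `lam`-weak `mu`-quasi strongly monotone: the inequality holds for some solution `xs`
of `F xs = 0`. -/
def WeakQuasiStronglyMonotone {d : ℕ}
    (F : EuclideanSpace ℝ (Fin d) → EuclideanSpace ℝ (Fin d)) (lam mu : ℝ) : Prop :=
  ∃ xs, F xs = 0 ∧ ∀ x, mu * ‖x - xs‖ ^ 2 - lam ≤ inner ℝ (F x) (x - xs)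

/-- `F` has at most `l`-linear growth. -/
def LinearGrowth {d : ℕ}
    (F : EuclideanSpace ℝ (Fin d) → EuclideanSpace ℝ (Fin d)) (l : ℝ) : Prop :=
  ∀ x, ‖F x‖ ≤ l * (1 + ‖x‖)

/-! ### Noise

The random field of the `k`-th oracle call is `x ↦ U x (ξ k ω)`, where `U` is jointly measurable
and `ξ 0, ξ 1, …` are i.i.d. random elements of a measurable space `S`. -/

/-- The random fields `x ↦ U x (ξ k ·)` are i.i.d., centred, with second moments at most `σ ^ 2`.
As `ξ k` is independent of everything that happened before the `k`-th call, the conditional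
moments given the past are the unconditional ones. -/
structure IsNoise {d : ℕ} {Ω S : Type*} [MeasurableSpace Ω] [MeasurableSpace S]
    (Pr : Measure Ω) (ξ : ℕ → Ω → S)
    (U : EuclideanSpace ℝ (Fin d) → S → EuclideanSpace ℝ (Fin d)) (σ : ℝ) : Prop where
  measurable_field : Measurable (Function.uncurry U)
  measurable_seed : ∀ k, Measurable (ξ k)
  indep : iIndepFun ξ Pr
  ident : ∀ k, IdentDistrib (ξ k) (ξ 0) Pr Pr
  mean_zero : ∀ k x, ∫ ω, U x (ξ k ω) ∂Pr = 0
  second_moment : ∀ k x, ∫⁻ ω, ‖U x (ξ k ω)‖ₑ ^ 2 ∂Pr ≤ ENNReal.ofReal (σ ^ 2)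

/-- The noise at `x` is a sum of two independent random variables, the first of which has a
Lebesgue density `p x`; the densities are bounded away from zero on bounded sets, uniformly over
`x` in a bounded set. -/
def HasPositiveDensityPart {d : ℕ} {Ω S : Type*} [MeasurableSpace Ω]
    (Pr : Measure Ω) (ξ : ℕ → Ω → S)
    (U : EuclideanSpace ℝ (Fin d) → S → EuclideanSpace ℝ (Fin d)) : Prop :=
  ∃ p : EuclideanSpace ℝ (Fin d) → EuclideanSpace ℝ (Fin d) → ℝ≥0∞,
    (∀ x, Measurable (p x)) ∧
    (∀ k x, ∃ Ua Ub : Ω → EuclideanSpace ℝ (Fin d),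
      Measurable Ua ∧ Measurable Ub ∧ IndepFun Ua Ub Pr ∧
      (∀ ω, U x (ξ k ω) = Ua ω + Ub ω) ∧
      Pr.map Ua = volume.withDensity (p x)) ∧
    (∀ C T : Set (EuclideanSpace ℝ (Fin d)), Bornology.IsBounded C → Bornology.IsBounded T →
      0 < ⨅ x ∈ C, ⨅ t ∈ T, p x t)

/-! ### Algorithms -/

/-- The iterates of stochastic gradient descent ascent with step-size `γ`. -/
def sgda {d : ℕ} {Ω S : Type*}
    (F : EuclideanSpace ℝ (Fin d) → EuclideanSpace ℝ (Fin d))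
    (U : EuclideanSpace ℝ (Fin d) → S → EuclideanSpace ℝ (Fin d)) (ξ : ℕ → Ω → S) (γ : ℝ)
    (X₀ : Ω → EuclideanSpace ℝ (Fin d)) : ℕ → Ω → EuclideanSpace ℝ (Fin d)
  | 0, ω => X₀ ω
  | n + 1, ω =>
    sgda F U ξ γ X₀ n ω -
      γ • (F (sgda F U ξ γ X₀ n ω) + U (sgda F U ξ γ X₀ n ω) (ξ n ω))

/-- The iterates of stochastic extragradient with step-sizes `γ` (look-ahead) and `α * γ`
(update). Step `n` makes the oracle calls `2 * n` (at `X_n`) and `2 * n + 1` (at `X_{n+1/2}`). -/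
def seg {d : ℕ} {Ω S : Type*}
    (F : EuclideanSpace ℝ (Fin d) → EuclideanSpace ℝ (Fin d))
    (U : EuclideanSpace ℝ (Fin d) → S → EuclideanSpace ℝ (Fin d)) (ξ : ℕ → Ω → S) (γ α : ℝ)
    (X₀ : Ω → EuclideanSpace ℝ (Fin d)) : ℕ → Ω → EuclideanSpace ℝ (Fin d)
  | 0, ω => X₀ ω
  | n + 1, ω =>
    let x := seg F U ξ γ α X₀ n ω
    let y := x - γ • (F x + U x (ξ (2 * n) ω))
    x - (α * γ) • (F y + U y (ξ (2 * n + 1) ω))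

/-! ### Markov chains on a measurable space -/

/-- `∫_{A 1} P(y, dy₁) ∫_{A 2} P(y₁, dy₂) ⋯ P(y_{n-1}, A n)`. -/
def followProb {E : Type*} [MeasurableSpace E] (P : Kernel E E) :
    ℕ → (ℕ → Set E) → E → ℝ≥0∞
  | 0, _, _ => 1
  | n + 1, A, y => ∫⁻ z in A 1, followProb P n (fun i => A (i + 1)) z ∂(P y)

/-- `Φ` is a time-homogeneous Markov chain with transition kernel `P` and initial distribution
`μ₀`, in terms of its finite-dimensional distributions. -/
def IsMarkovChain {E Ω : Type*} [MeasurableSpace E] [MeasurableSpace Ω] (Pr : Measure Ω)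
    (P : Kernel E E) (μ₀ : Measure E) (Φ : ℕ → Ω → E) : Prop :=
  (∀ n, Measurable (Φ n)) ∧
  ∀ (n : ℕ) (A : ℕ → Set E), (∀ i, MeasurableSet (A i)) →
    Pr {ω | ∀ i ≤ n, Φ i ω ∈ A i} = ∫⁻ y in A 0, followProb P n A y ∂μ₀

/-- The law on path space of the Markov chain with kernel `P` started at `x`. -/
def chainLaw {E : Type*} [MeasurableSpace E] (P : Kernel E E) [IsMarkovKernel P] (x : E) :
    Measure (ℕ → E) :=
  Kernel.trajMeasure (X := fun _ => E) (Measure.dirac x)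
    (fun n => P.comap (fun h : (Π _ : Finset.Iic n, E) => h ⟨n, Finset.mem_Iic.2 le_rfl⟩)
      (measurable_pi_apply _))

/-- `φ` is an irreducibility measure of `P`. -/
def IsIrreducibilityMeasure {E : Type*} [MeasurableSpace E] (P : Kernel E E)
    (φ : Measure E) : Prop :=
  ∀ x, ∀ A, MeasurableSet A → 0 < φ A → ∃ n : ℕ, 0 < n ∧ 0 < (P ^ n) x A

/-- `P` is `ψ`-irreducible: `ψ` is a non-zero `σ`-finite irreducibility measure, and it is maximal,
i.e. all other irreducibility measures are absolutely continuous with respect to it. -/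
def IsPsiIrreducible {E : Type*} [MeasurableSpace E] (P : Kernel E E) (ψ : Measure E) : Prop :=
  ψ ≠ 0 ∧ SigmaFinite ψ ∧ IsIrreducibilityMeasure P ψ ∧
    ∀ φ : Measure E, IsIrreducibilityMeasure P φ → φ ≪ ψ

/-- Strong aperiodicity of the (irreducible) kernel `P`. -/
def IsStronglyAperiodic {E : Type*} [MeasurableSpace E] (P : Kernel E E) : Prop :=
  ∃ (A : Set E) (ν : Measure E), MeasurableSet A ∧ 0 < ν A ∧
    ∀ x ∈ A, ∀ B, MeasurableSet B → ν B ≤ P x B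

/-- The number of visits of a path to `A`. -/
def visits {E : Type*} (A : Set E) (w : ℕ → E) : ℝ≥0∞ :=
  ∑' n, A.indicator (fun _ => 1) (w n)

/-- Harris recurrence of the `ψ`-irreducible kernel `P`. -/
def IsHarrisRecurrent {E : Type*} [MeasurableSpace E] (P : Kernel E E) [IsMarkovKernel P]
    (ψ : Measure E) : Prop :=
  ∀ A, MeasurableSet A → 0 < ψ A → ∀ x ∈ A, chainLaw P x {w | visits A w = ⊤} = 1

/-- Positive recurrence of the `ψ`-irreducible kernel `P`. -/
def IsPositiveRecurrent {E : Type*} [MeasurableSpace E] (P : Kernel E E) (ψ : Measure E) : Prop :=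
  ∀ A, MeasurableSet A → 0 < ψ A → ∀ x ∈ A, 0 < limsup (fun n => (P ^ n) x A) atTop

end

/-!
Quasi-strong monotonicity makes the noiseless step contract squared distances to `xs` up to an
additive error, for the extragradient step because the look-ahead error `F y - F x` is dominated
by the Lipschitz bound. As the noise has bounded second moments, `‖x - xs‖ ^ 2` is a geometric
drift function. The positive density of the noise makes the transition laws from a ball dominate a
common multiple of Lebesgue measure on that ball, so that sublevel sets of the drift function are
small. The rest is the Meyn–Tweedie theory of such chains: by the drift, the chain returns to a
sublevel set infinitely often, and by smallness each return gives it a chance bounded below of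
entering a given set of positive measure, whence Harris recurrence; splitting off the
minorizing part of the kernel, and summing the residual kernel over the time to the next
regeneration, gives a finite invariant measure.
-/

section MarkovChains

variable {E Ω : Type*} [MeasurableSpace E] [MeasurableSpace Ω]

theorem measurable_followProb (P : Kernel E E) (n : ℕ) {A : ℕ → Set E}
    (hA : ∀ i, MeasurableSet (A i)) : Measurable (followProb P n A) := by
  induction n generalizing A with
  | zero => exact measurable_const
  | succ n ih =>
    have hmeas := ((ih fun i => hA (i + 1)).indicator (hA 1)).lintegral_kernel (κ := P)
    simp only [lintegral_indicator (hA 1)] at hmeas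
    exact hmeas

theorem followProb_le_one (P : Kernel E E) [IsMarkovKernel P] (n : ℕ) (A : ℕ → Set E) (x : E) :
    followProb P n A x ≤ 1 := by
  induction n generalizing A x with
  | zero => exact le_rfl
  | succ n ih =>
    calc followProb P (n + 1) A x
        ≤ ∫⁻ _ in A 1, 1 ∂(P x) := lintegral_mono fun z => ih _ z
      _ ≤ 1 := by rw [setLIntegral_one]; exact prob_le_one

/-- The trajectory of the process `Φ` up to time `n`. -/
def history (Φ : ℕ → Ω → E) (n : ℕ) (ω : Ω) : Finset.Iic n → E := fun i => Φ i ω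

/-- The transition kernel `P`, applied to the last point of a trajectory up to time `n`. -/
abbrev historyKernel (P : Kernel E E) (n : ℕ) : Kernel (Finset.Iic n → E) E :=
  P.comap (fun h => h ⟨n, Finset.mem_Iic.2 le_rfl⟩) (measurable_pi_apply _)

/-- The Markov property: given the trajectory up to time `n`, the next point has law `P (Φ n)`.
It is stated through joint laws, so that no regular conditional distribution is needed. -/
def HasMarkovProperty (Pr : Measure Ω) (P : Kernel E E) (Φ : ℕ → Ω → E) : Prop :=
  ∀ n, Pr.map (fun ω => (history Φ n ω, Φ (n + 1) ω)) =
    Pr.map (history Φ n) ⊗ₘ historyKernel P n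

theorem measurable_history {Φ : ℕ → Ω → E} (hΦ : ∀ n, Measurable (Φ n)) (n : ℕ) :
    Measurable (history Φ n) :=
  measurable_pi_lambda _ fun i => hΦ i

namespace HasMarkovProperty

variable {Pr : Measure Ω} [SFinite Pr] {P : Kernel E E} [IsSFiniteKernel P] {Φ : ℕ → Ω → E}

theorem setLIntegral_succ (hM : HasMarkovProperty Pr P Φ) (hΦ : ∀ n, Measurable (Φ n)) {n : ℕ}
    {A : ℕ → Set E} (hA : ∀ i, MeasurableSet (A i)) {h : E → ℝ≥0∞} (hh : Measurable h) :
    ∫⁻ ω in {ω | ∀ i ≤ n, Φ i ω ∈ A i}, h (Φ (n + 1) ω) ∂Pr =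
      ∫⁻ ω in {ω | ∀ i ≤ n, Φ i ω ∈ A i}, ∫⁻ z, h z ∂(P (Φ n ω)) ∂Pr := by
  let R : Set (Finset.Iic n → E) := Set.univ.pi fun i => A i
  have hR : MeasurableSet R := MeasurableSet.univ_pi fun i => hA i
  have hcyl : {ω | ∀ i ≤ n, Φ i ω ∈ A i} = history Φ n ⁻¹' R := by
    ext ω; simp [R, history]
  have hcyl' : history Φ n ⁻¹' R =
      (fun ω => (history Φ n ω, Φ (n + 1) ω)) ⁻¹' (R ×ˢ Set.univ) := by
    ext ω; simp
  have hhist := measurable_history hΦ n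
  have hh' : Measurable fun q : (Finset.Iic n → E) × E => h q.2 := hh.comp measurable_snd
  calc ∫⁻ ω in {ω | ∀ i ≤ n, Φ i ω ∈ A i}, h (Φ (n + 1) ω) ∂Pr
      = ∫⁻ q in R ×ˢ Set.univ, h q.2 ∂(Pr.map (history Φ n) ⊗ₘ historyKernel P n) := by
        rw [← hM n, setLIntegral_map (hR.prod .univ) hh'
          (hhist.prodMk (hΦ _)), ← hcyl', ← hcyl]
    _ = ∫⁻ w in R, ∫⁻ z, h z ∂(historyKernel P n w) ∂(Pr.map (history Φ n)) := by
        rw [Measure.setLIntegral_compProd hh' hR .univ]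
        simp only [Measure.restrict_univ]
    _ = ∫⁻ ω in {ω | ∀ i ≤ n, Φ i ω ∈ A i}, ∫⁻ z, h z ∂(P (Φ n ω)) ∂Pr := by
        rw [setLIntegral_map hR hh.lintegral_kernel hhist, hcyl]
        rfl

theorem measure_cylinder_eq (hM : HasMarkovProperty Pr P Φ) (hΦ : ∀ n, Measurable (Φ n))
    {A : ℕ → Set E} (hA : ∀ i, MeasurableSet (A i)) (m k : ℕ) :
    Pr {ω | ∀ i ≤ m + k, Φ i ω ∈ A i} =
      ∫⁻ ω in {ω | ∀ i ≤ m, Φ i ω ∈ A i}, followProb P k (fun i => A (m + i)) (Φ m ω) ∂Pr := by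
  induction k generalizing m with
  | zero => simp [followProb]
  | succ k ih =>
    have hcyl : {ω | ∀ i ≤ m + 1, Φ i ω ∈ A i} =
        Φ (m + 1) ⁻¹' A (m + 1) ∩ {ω | ∀ i ≤ m, Φ i ω ∈ A i} := by
      ext ω
      simp only [Nat.le_succ_iff_eq_or_le, forall_eq_or_imp, Set.mem_ofPred_eq, Set.mem_inter_iff,
        Set.mem_preimage]
    have hlast : MeasurableSet (Φ (m + 1) ⁻¹' A (m + 1)) := hΦ _ (hA _)
    have hfollow : Measurable (followProb P k fun i => A (m + 1 + i)) :=
      measurable_followProb P k fun i => hA _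
    rw [← Nat.succ_add_eq_add_succ, ih (m + 1), hcyl, ← Measure.restrict_restrict hlast,
      ← lintegral_indicator hlast]
    refine (hM.setLIntegral_succ hΦ hA (hfollow.indicator (hA (m + 1)))).trans ?_
    refine lintegral_congr fun ω => ?_
    rw [lintegral_indicator (hA _)]
    simp only [followProb, add_assoc, add_comm 1]

theorem isMarkovChain (hM : HasMarkovProperty Pr P Φ) (hΦ : ∀ n, Measurable (Φ n)) :
    IsMarkovChain Pr P (Pr.map (Φ 0)) Φ := by
  refine ⟨hΦ, fun n A hA => ?_⟩
  rw [setLIntegral_map (hA 0) (measurable_followProb P n hA) (hΦ 0)]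
  simpa [Set.preimage] using hM.measure_cylinder_eq hΦ hA 0 n

end HasMarkovProperty

instance (P : Kernel E E) [IsMarkovKernel P] (x : E) : IsProbabilityMeasure (chainLaw P x) :=
  inferInstanceAs (IsProbabilityMeasure (Kernel.trajMeasure _ _))

theorem chainLaw_map_zero (P : Kernel E E) [IsMarkovKernel P] (x : E) :
    (chainLaw P x).map (fun w => w 0) = Measure.dirac x := by
  let e : (Finset.Iic 0 → E) → E := fun v => v ⟨0, Finset.mem_Iic.2 le_rfl⟩
  have he : Measurable e := measurable_pi_apply _
  have hf : (fun w : ℕ → E => w 0) = e ∘ Preorder.frestrictLe (π := fun _ => E) 0 := rfl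
  rw [hf, ← Measure.map_map he (Preorder.measurable_frestrictLe 0), chainLaw,
    Kernel.trajMeasure, Measure.map_comp _ _ (Preorder.measurable_frestrictLe 0),
    Kernel.traj_map_frestrictLe, Kernel.partialTraj_self, Measure.id_comp]
  exact (congrArg (Measure.map e) (Measure.map_dirac' (MeasurableEquiv.measurable _) _)).trans
    (Measure.map_dirac' he _)

theorem hasMarkovProperty_chainLaw (P : Kernel E E) [IsMarkovKernel P] (x : E) :
    HasMarkovProperty (chainLaw P x) P (fun n w => w n) := fun n =>
  (Kernel.map_frestrictLe_trajMeasure_compProd_eq_map_trajMeasure (X := fun _ => E)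
    (μ₀ := Measure.dirac x) (κ := historyKernel P) (a := n)).symm

theorem isMarkovChain_chainLaw (P : Kernel E E) [IsMarkovKernel P] (x : E) :
    IsMarkovChain (chainLaw P x) P (Measure.dirac x) (fun n w => w n) := by
  rw [← chainLaw_map_zero P x]
  exact (hasMarkovProperty_chainLaw P x).isMarkovChain measurable_pi_apply

end MarkovChains

section RandomRecursions

variable {E Ω S Z : Type*} [MeasurableSpace E] [MeasurableSpace S] [MeasurableSpace Z]

/-- The kernel which sends `x` to the law of `f x z`, for `z` drawn from `ρ`. -/
noncomputable def randomMapKernel (ρ : Measure Z) [SFinite ρ] (f : E → Z → S) : Kernel E S :=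
  (Kernel.id ×ₖ Kernel.const E ρ).map (Function.uncurry f)

theorem randomMapKernel_apply (ρ : Measure Z) [SFinite ρ] {f : E → Z → S}
    (hf : Measurable (Function.uncurry f)) (x : E) :
    randomMapKernel ρ f x = ρ.map (f x) := by
  rw [randomMapKernel, Kernel.map_apply _ hf, Kernel.prod_apply, Kernel.id_apply,
    Kernel.const_apply, Measure.dirac_prod, Measure.map_map hf measurable_prodMk_left]
  rfl

theorem isMarkovKernel_randomMapKernel (ρ : Measure Z) [IsProbabilityMeasure ρ] {f : E → Z → S}
    (hf : Measurable (Function.uncurry f)) : IsMarkovKernel (randomMapKernel ρ f) :=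
  Kernel.IsMarkovKernel.map _ hf

theorem bind_randomMapKernel (ν : Measure E) [SFinite ν] (ρ : Measure Z) [SFinite ρ]
    {f : E → Z → S} (hf : Measurable (Function.uncurry f)) :
    ν.bind (randomMapKernel ρ f) = (ν.prod ρ).map (Function.uncurry f) := by
  rw [randomMapKernel, ← Measure.map_comp _ _ hf, ← Measure.compProd_eq_comp_prod,
    Measure.compProd_const]

theorem exists_measurable_eq_of_recursion {f : E → Z → E} (hf : Measurable (Function.uncurry f))
    {Φ : ℕ → Ω → E} {ζ : ℕ → Ω → Z} (hrec : ∀ n ω, Φ (n + 1) ω = f (Φ n ω) (ζ n ω)) {n i : ℕ}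
    (hi : i ≤ n) :
    ∃ g : E × (Finset.range n → Z) → E,
      Measurable g ∧ ∀ ω, Φ i ω = g (Φ 0 ω, fun k => ζ k ω) := by
  induction i with
  | zero => exact ⟨Prod.fst, measurable_fst, fun ω => rfl⟩
  | succ i ih =>
    obtain ⟨g, hg, hΦg⟩ := ih (by omega)
    refine ⟨fun q => f (g q) (q.2 ⟨i, Finset.mem_range.2 hi⟩), ?_, fun ω => ?_⟩
    · exact hf.comp (hg.prodMk ((measurable_pi_apply _).comp measurable_snd))
    · rw [hrec, hΦg]

variable [MeasurableSpace Ω] {Pr : Measure Ω}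

theorem indepFun_history_of_recursion {f : E → Z → E} (hf : Measurable (Function.uncurry f))
    {Φ : ℕ → Ω → E} {ζ : ℕ → Ω → Z} (hrec : ∀ n ω, Φ (n + 1) ω = f (Φ n ω) (ζ n ω)) {n : ℕ}
    (hind : IndepFun (fun ω => (Φ 0 ω, fun k : Finset.range n => ζ k ω)) (ζ n) Pr) :
    IndepFun (history Φ n) (ζ n) Pr := by
  choose g hg hΦg using fun i : Finset.Iic n =>
    exists_measurable_eq_of_recursion hf hrec (Finset.mem_Iic.1 i.2)
  have hhist : history Φ n =
      (fun q i => g i q) ∘ fun ω => (Φ 0 ω, fun k : Finset.range n => ζ k ω) := by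
    ext ω i
    exact hΦg i ω
  rw [hhist]
  exact hind.comp (measurable_pi_lambda _ hg) measurable_id

variable [IsProbabilityMeasure Pr]

theorem hasMarkovProperty_of_recursion {ρ : Measure Z} [IsProbabilityMeasure ρ] {f : E → Z → E}
    (hf : Measurable (Function.uncurry f)) {Φ : ℕ → Ω → E} {ζ : ℕ → Ω → Z}
    (hΦ : ∀ n, Measurable (Φ n)) (hζ : ∀ n, Measurable (ζ n)) (hlaw : ∀ n, Pr.map (ζ n) = ρ)
    (hind : ∀ n, IndepFun (fun ω => (Φ 0 ω, fun k : Finset.range n => ζ k ω)) (ζ n) Pr)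
    (hrec : ∀ n ω, Φ (n + 1) ω = f (Φ n ω) (ζ n ω)) :
    HasMarkovProperty Pr (randomMapKernel ρ f) Φ := by
  intro n
  have := isMarkovKernel_randomMapKernel ρ hf
  have hhist := measurable_history hΦ n
  let e : Finset.Iic n := ⟨n, Finset.mem_Iic.2 le_rfl⟩
  let G : (Finset.Iic n → E) × Z → (Finset.Iic n → E) × E := fun q => (q.1, f (q.1 e) q.2)
  have hlast : Measurable fun q : (Finset.Iic n → E) × Z => (q.1 e, q.2) :=
    ((measurable_pi_apply e).comp measurable_fst).prodMk measurable_snd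
  have hG : Measurable G := measurable_fst.prodMk (hf.comp hlast)
  have hjoint : Pr.map (fun ω => (history Φ n ω, ζ n ω)) = (Pr.map (history Φ n)).prod ρ := by
    rw [← hlaw n]
    exact (indepFun_history_of_recursion hf hrec (hind n)).map_prod_eq_prod_map_map
      hhist.aemeasurable (hζ n).aemeasurable
  have hnext : (fun ω => (history Φ n ω, Φ (n + 1) ω)) = G ∘ fun ω => (history Φ n ω, ζ n ω) := by
    ext1 ω
    simp only [hrec, Function.comp_apply, G]
    rfl
  rw [hnext, ← Measure.map_map hG (hhist.prodMk (hζ n)), hjoint]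
  refine Measure.ext_of_lintegral _ fun h hh => ?_
  have hhG : Measurable fun q => h (G q) := hh.comp hG
  rw [lintegral_map hh hG, lintegral_prod _ hhG.aemeasurable, Measure.lintegral_compProd hh]
  refine lintegral_congr fun w => ?_
  have hhw : Measurable fun z => h (w, z) := hh.comp measurable_prodMk_left
  rw [historyKernel, Kernel.comap_apply, randomMapKernel_apply ρ hf,
    lintegral_map hhw hf.of_uncurry_left]

theorem isMarkovChain_of_recursion {ρ : Measure Z} [IsProbabilityMeasure ρ] {f : E → Z → E}
    (hf : Measurable (Function.uncurry f)) {Φ : ℕ → Ω → E} {ζ : ℕ → Ω → Z}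
    (hΦ : Measurable (Φ 0)) (hζ : ∀ n, Measurable (ζ n)) (hlaw : ∀ n, Pr.map (ζ n) = ρ)
    (hind : ∀ n, IndepFun (fun ω => (Φ 0 ω, fun k : Finset.range n => ζ k ω)) (ζ n) Pr)
    (hrec : ∀ n ω, Φ (n + 1) ω = f (Φ n ω) (ζ n ω)) :
    IsMarkovChain Pr (randomMapKernel ρ f) (Pr.map (Φ 0)) Φ := by
  have := isMarkovKernel_randomMapKernel ρ hf
  have hΦn : ∀ n, Measurable (Φ n) := by
    intro n
    induction n with
    | zero => exact hΦ
    | succ n ih =>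
      rw [funext (hrec n)]
      exact hf.comp (ih.prodMk (hζ n))
  exact (hasMarkovProperty_of_recursion hf hΦn hζ hlaw hind hrec).isMarkovChain hΦn

theorem indepFun_prodMk_left_of_indepFun_prodMk_right {X : Ω → E} {Y : Ω → S} {W : Ω → Z}
    (hX : Measurable X) (hY : Measurable Y) (hW : Measurable W)
    (hXYW : IndepFun X (fun ω => (Y ω, W ω)) Pr) (hYW : IndepFun Y W Pr) :
    IndepFun (fun ω => (X ω, Y ω)) W Pr := by
  have hXY : IndepFun X Y Pr := hXYW.comp measurable_id measurable_fst
  have hlaw := hXYW.map_prod_eq_prod_map_map hX.aemeasurable (hY.prodMk hW).aemeasurable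
  rw [hYW.map_prod_eq_prod_map_map hY.aemeasurable hW.aemeasurable,
    ← Measure.prodAssoc_prod] at hlaw
  rw [indepFun_iff_map_prod_eq_prod_map_map (hX.prodMk hY).aemeasurable hW.aemeasurable,
    hXY.map_prod_eq_prod_map_map hX.aemeasurable hY.aemeasurable]
  apply MeasurableEquiv.prodAssoc.map_measurableEquiv_injective
  rw [← hlaw, Measure.map_map (MeasurableEquiv.measurable _) ((hX.prodMk hY).prodMk hW)]
  rfl

theorem indepFun_prodMk_finset {ξ : ℕ → Ω → S} {X₀ : Ω → E} (hX₀ : Measurable X₀)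
    (hξ : ∀ k, Measurable (ξ k)) (hind : IndepFun X₀ (fun ω k => ξ k ω) Pr)
    (hξind : iIndepFun ξ Pr) {I J : Finset ℕ} (hIJ : Disjoint I J) :
    IndepFun (fun ω => (X₀ ω, fun i : I => ξ i ω)) (fun ω (j : J) => ξ j ω) Pr :=
  indepFun_prodMk_left_of_indepFun_prodMk_right hX₀ (measurable_pi_lambda _ fun i => hξ i)
    (measurable_pi_lambda _ fun j => hξ j)
    (hind.comp (φ := id) (ψ := fun w : ℕ → S => ((fun i : I => w i), fun j : J => w j))
      measurable_id (by fun_prop))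
    (hξind.indepFun_finset I J hIJ hξ)

end RandomRecursions

section Visits

variable {E : Type*} [MeasurableSpace E] {P : Kernel E E} [IsMarkovKernel P]

theorem tendsto_followProb_of_forall_shift {A : ℕ → Set E} (hA : ∀ i, MeasurableSet (A i))
    (hlim : ∀ z, Tendsto (fun n => followProb P n (fun i => A (i + 1)) z) atTop (𝓝 0)) (x : E) :
    Tendsto (fun n => followProb P n A x) atTop (𝓝 0) := by
  rw [← tendsto_add_atTop_iff_nat 1, ← lintegral_zero (μ := (P x).restrict (A 1))]
  exact tendsto_lintegral_of_dominated_convergence (fun _ => 1)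
    (fun n => measurable_followProb P n fun i => hA (i + 1))
    (fun n => Eventually.of_forall (followProb_le_one P n _))
    (by simp) (Eventually.of_forall hlim)

theorem tendsto_followProb_of_forall_ge_eq {B : Set E}
    (hlim : ∀ x, Tendsto (fun n => followProb P n (fun _ => B) x) atTop (𝓝 0)) {N : ℕ}
    {A : ℕ → Set E} (hA : ∀ i, MeasurableSet (A i)) (hAB : ∀ i ≥ N, A i = B) (x : E) :
    Tendsto (fun n => followProb P n A x) atTop (𝓝 0) := by
  induction N generalizing A x with
  | zero =>
    obtain rfl : A = fun _ => B := funext fun i => hAB i i.zero_le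
    exact hlim x
  | succ N ih =>
    exact tendsto_followProb_of_forall_shift hA
      (ih (fun i => hA (i + 1)) fun i hi => hAB (i + 1) (by omega)) x

theorem chainLaw_forall_ge_mem_eq_zero {B : Set E} (hB : MeasurableSet B)
    (hlim : ∀ x, Tendsto (fun n => followProb P n (fun _ => B) x) atTop (𝓝 0)) (N : ℕ) (x : E) :
    chainLaw P x {w | ∀ i ≥ N, w i ∈ B} = 0 := by
  classical
  let A : ℕ → Set E := fun i => if N ≤ i then B else Set.univ
  have hA (i : ℕ) : MeasurableSet (A i) := by
    dsimp only [A]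
    split_ifs
    exacts [hB, .univ]
  have hAlim : Tendsto (fun n => followProb P n A x) atTop (𝓝 0) :=
    tendsto_followProb_of_forall_ge_eq hlim hA (fun i hi => if_pos hi) x
  refine le_antisymm (ge_of_tendsto' hAlim fun n => ?_) zero_le
  calc chainLaw P x {w | ∀ i ≥ N, w i ∈ B}
      ≤ chainLaw P x {w | ∀ i ≤ n, w i ∈ A i} := by
        refine measure_mono fun w hw i _ => ?_
        dsimp only [A]
        split_ifs with hi
        exacts [hw i hi, Set.mem_univ _]
    _ = ∫⁻ y in A 0, followProb P n A y ∂(Measure.dirac x) :=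
        (isMarkovChain_chainLaw P x).2 n A hA
    _ ≤ ∫⁻ y, followProb P n A y ∂(Measure.dirac x) := setLIntegral_le_lintegral _ _
    _ = followProb P n A x := lintegral_dirac' x (measurable_followProb P n hA)

theorem visits_eq_top_of_frequently {E : Type*} {A : Set E} {w : ℕ → E}
    (hw : ∃ᶠ n in atTop, w n ∈ A) : visits A w = ⊤ := by
  have : Infinite {n | w n ∈ A} := (Nat.frequently_atTop_iff_infinite.1 hw).to_subtype
  calc visits A w = ∑' n, ({n | w n ∈ A} : Set ℕ).indicator (fun _ => (1 : ℝ≥0∞)) n := rfl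
    _ = ⊤ := by
      rw [← tsum_subtype]
      exact ENNReal.tsum_const_eq_top_of_ne_zero one_ne_zero

theorem chainLaw_visits_eq_top {A : Set E} (hA : MeasurableSet A)
    (hlim : ∀ x, Tendsto (fun n => followProb P n (fun _ => Aᶜ) x) atTop (𝓝 0)) (x : E) :
    chainLaw P x {w | visits A w = ⊤} = 1 := by
  have hvisits : ∀ᵐ w ∂(chainLaw P x), visits A w = ⊤ := by
    have hexit : ∀ᵐ w ∂(chainLaw P x), ∀ N, ¬∀ i ≥ N, w i ∈ Aᶜ := by
      rw [ae_all_iff]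
      intro N
      simpa only [ae_iff, not_not] using chainLaw_forall_ge_mem_eq_zero hA.compl hlim N x
    filter_upwards [hexit] with w hw
    refine visits_eq_top_of_frequently (frequently_atTop.2 fun N => ?_)
    simpa using hw N
  rw [measure_congr (eventuallyEq_univ.2 hvisits), measure_univ]

end Visits

section Potentials

variable {E : Type*} [MeasurableSpace E] {Q : Kernel E E} {W : E → ℝ≥0∞}

theorem tsum_pow_apply_univ_le (hW : ∀ x, ∫⁻ z, W z ∂(Q x) + 1 ≤ W x) (x : E) :
    ∑' n, (Q ^ n) x Set.univ ≤ W x := by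
  rw [ENNReal.tsum_eq_iSup_nat]
  refine iSup_le fun n => ?_
  induction n generalizing x with
  | zero => simp
  | succ n ih =>
    calc ∑ k ∈ Finset.range (n + 1), (Q ^ k) x Set.univ
        = ∑ k ∈ Finset.range n, ∫⁻ z, (Q ^ k) z Set.univ ∂(Q x) + 1 := by
          rw [Finset.sum_range_succ']
          congr 1
          · refine Finset.sum_congr rfl fun k _ => ?_
            rw [add_comm, Kernel.pow_add_apply_eq_lintegral _ _ _ _ .univ, pow_one]
          · exact measure_univ (μ := Kernel.id x)
      _ = ∫⁻ z, ∑ k ∈ Finset.range n, (Q ^ k) z Set.univ ∂(Q x) + 1 := by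
          rw [lintegral_finsetSum]
          exact fun k _ => (Q ^ k).measurable_coe .univ
      _ ≤ ∫⁻ z, W z ∂(Q x) + 1 := by gcongr with z; exact ih z
      _ ≤ W x := hW x

theorem followProb_const_eq_restrict_pow {P : Kernel E E} {B : Set E} (hB : MeasurableSet B)
    (n : ℕ) (x : E) :
    followProb P n (fun _ => B) x = ((P.restrict hB) ^ n) x Set.univ := by
  induction n generalizing x with
  | zero => exact (measure_univ (μ := Kernel.id x)).symm
  | succ n ih =>
    rw [add_comm n, Kernel.pow_add_apply_eq_lintegral _ _ _ _ .univ, pow_one,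
      Kernel.restrict_apply, add_comm 1]
    exact lintegral_congr ih

theorem tendsto_followProb_of_restrict_drift {P : Kernel E E} {B : Set E} (hB : MeasurableSet B)
    (hW : ∀ x, ∫⁻ z, W z ∂(P.restrict hB x) + 1 ≤ W x) {x : E} (hx : W x ≠ ⊤) :
    Tendsto (fun n => followProb P n (fun _ => B) x) atTop (𝓝 0) := by
  simp only [followProb_const_eq_restrict_pow hB]
  exact ENNReal.tendsto_atTop_zero_of_tsum_ne_top
    (ne_top_of_le_ne_top hx (tsum_pow_apply_univ_le hW x))

theorem drift_add_const {V : E → ℝ≥0∞} {K : Set E} {b δ : ℝ≥0∞} (hδ : δ ≠ 0)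
    (hmass : ∀ x, K.indicator (fun _ => δ) x + Q x Set.univ ≤ 1)
    (hV : ∀ x, ∫⁻ z, V z ∂(Q x) + 1 ≤ V x + K.indicator (fun _ => b) x) (x : E) :
    ∫⁻ z, (V z + b / δ) ∂(Q x) + 1 ≤ V x + b / δ := by
  have hindicator : K.indicator (fun _ => b) x = b / δ * K.indicator (fun _ => δ) x := by
    by_cases hx : x ∈ K
    · have hδtop : δ ≠ ⊤ := ne_top_of_le_ne_top ENNReal.one_ne_top
        (le_self_add.trans (by simpa [hx] using hmass x))
      simp [hx, ENNReal.div_mul_cancel hδ hδtop]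
    · simp [hx]
  calc ∫⁻ z, (V z + b / δ) ∂(Q x) + 1
      = ∫⁻ z, V z ∂(Q x) + 1 + b / δ * Q x Set.univ := by
        rw [lintegral_add_right _ measurable_const, lintegral_const, add_right_comm]
    _ ≤ V x + K.indicator (fun _ => b) x + b / δ * Q x Set.univ := add_le_add (hV x) le_rfl
    _ = V x + b / δ * (K.indicator (fun _ => δ) x + Q x Set.univ) := by
        rw [hindicator, mul_add, add_assoc]
    _ ≤ V x + b / δ := by gcongr; exact mul_le_of_le_one_right' (hmass x)

end Potentials

section InvariantMeasures

variable {E : Type*} [MeasurableSpace E]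

/-- The expected occupation measure `∑ n, ν Gⁿ` of the (sub-Markovian) chain with kernel `G` and
initial distribution `ν`. -/
noncomputable def greenMeasure (G : Kernel E E) (ν : Measure E) : Measure E :=
  Measure.sum fun n => ν.bind ⇑(G ^ n)

theorem greenMeasure_apply (G : Kernel E E) (ν : Measure E) {s : Set E} (hs : MeasurableSet s) :
    greenMeasure G ν s = ∑' n, ∫⁻ x, (G ^ n) x s ∂ν := by
  rw [greenMeasure, Measure.sum_apply _ hs]
  exact tsum_congr fun n => Measure.bind_apply hs (G ^ n).measurable.aemeasurable

theorem greenMeasure_eq_add_bind (G : Kernel E E) (ν : Measure E) :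
    greenMeasure G ν = ν + (greenMeasure G ν).bind G := by
  ext s hs
  rw [Measure.add_apply, greenMeasure_apply G ν hs, tsum_eq_zero_add' ENNReal.summable,
    Measure.bind_apply hs G.measurable.aemeasurable, greenMeasure, lintegral_sum_measure]
  congr 1
  · rw [← Measure.bind_apply hs (G ^ 0).measurable.aemeasurable]
    exact congrArg (fun μ : Measure E => μ s) (Measure.id_comp (μ := ν))
  · refine tsum_congr fun n => ?_
    rw [Measure.lintegral_bind (G ^ n).measurable.aemeasurable (G.measurable_coe hs).aemeasurable]
    exact lintegral_congr fun x => Kernel.pow_succ_apply_eq_lintegral G n x hs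

theorem greenMeasure_univ_le {G : Kernel E E} {W : E → ℝ≥0∞}
    (hW : ∀ x, ∫⁻ z, W z ∂(G x) + 1 ≤ W x) (ν : Measure E) :
    greenMeasure G ν Set.univ ≤ ∫⁻ x, W x ∂ν := by
  rw [greenMeasure_apply G ν .univ,
    ← lintegral_tsum fun n => ((G ^ n).measurable_coe .univ).aemeasurable]
  exact lintegral_mono (tsum_pow_apply_univ_le hW)

/-- The kernel `P - 1_C ⊗ ν`: what remains of a step of `P` when the chain may regenerate from `ν`
at every visit to `C`. -/
noncomputable def residualKernel (P : Kernel E E) {C : Set E} (hC : MeasurableSet C)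
    {ν : Measure E} [IsFiniteMeasure ν] (hν : ∀ x ∈ C, ν ≤ P x) : Kernel E E where
  toFun x := P x - C.indicator (fun _ => ν) x
  measurable' := by
    refine Measure.measurable_of_measurable_coe _ fun s hs => ?_
    have heval (x : E) : (P x - C.indicator (fun _ => ν) x) s =
        P x s - C.indicator (fun _ => ν s) x := by
      by_cases hx : x ∈ C
      · simp [hx, Measure.sub_apply hs (hν x hx)]
      · simp [hx]
    simp only [heval]
    exact (P.measurable_coe hs).sub (measurable_const.indicator hC)

section Residual

variable {P : Kernel E E} {C : Set E} (hC : MeasurableSet C) {ν : Measure E} [IsFiniteMeasure ν]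
  (hν : ∀ x ∈ C, ν ≤ P x)

theorem residualKernel_add_indicator (x : E) :
    residualKernel P hC hν x + C.indicator (fun _ => ν) x = P x := by
  change (P x - C.indicator (fun _ => ν) x) + C.indicator (fun _ => ν) x = P x
  by_cases hx : x ∈ C
  · simp only [hx, Set.indicator_of_mem]
    exact Measure.sub_add_cancel_of_le (hν x hx)
  · simp [hx]

theorem residualKernel_le (x : E) : residualKernel P hC hν x ≤ P x :=
  (residualKernel_add_indicator hC hν x).symm ▸ Measure.le_add_right le_rfl

theorem indicator_add_residualKernel_univ [IsMarkovKernel P] (x : E) :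
    C.indicator (fun _ => ν Set.univ) x + residualKernel P hC hν x Set.univ = 1 := by
  rw [← measure_univ (μ := P x), ← residualKernel_add_indicator hC hν x, Measure.add_apply,
    add_comm]
  by_cases hx : x ∈ C <;> simp [hx]

theorem bind_eq_bind_residualKernel_add (μ : Measure E) :
    μ.bind P = μ.bind (residualKernel P hC hν) + μ C • ν := by
  ext s hs
  have heval (x : E) : P x s = residualKernel P hC hν x s + C.indicator (fun _ => ν s) x := by
    rw [← residualKernel_add_indicator hC hν x, Measure.add_apply]
    by_cases hx : x ∈ C <;> simp [hx]
  rw [Measure.add_apply, Measure.bind_apply hs P.measurable.aemeasurable,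
    Measure.bind_apply hs (residualKernel P hC hν).measurable.aemeasurable, lintegral_congr heval,
    lintegral_add_right _ (measurable_const.indicator hC), lintegral_indicator hC,
    setLIntegral_const, Measure.smul_apply, smul_eq_mul, mul_comm]

theorem invariant_greenMeasure_residualKernel [IsMarkovKernel P] (hν0 : ν ≠ 0)
    (hfin : greenMeasure (residualKernel P hC hν) ν Set.univ ≠ ⊤) :
    P.Invariant (greenMeasure (residualKernel P hC hν) ν) := by
  set S := greenMeasure (residualKernel P hC hν) ν with hS
  set T := S.bind (residualKernel P hC hν)
  have hST : S = T + ν := by rw [add_comm, hS]; exact greenMeasure_eq_add_bind _ ν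
  have hSP : S.bind P = T + S C • ν := bind_eq_bind_residualKernel_add hC hν S
  have hTfin : T Set.univ ≠ ⊤ := ne_top_of_le_ne_top hfin (by rw [hST]; exact le_self_add)
  have hmass : T Set.univ + S C * ν Set.univ = T Set.univ + 1 * ν Set.univ := by
    calc T Set.univ + S C * ν Set.univ = S.bind P Set.univ := by rw [hSP]; rfl
      _ = S Set.univ := by
        rw [Measure.bind_apply .univ P.measurable.aemeasurable]
        simp only [measure_univ, lintegral_one]
      _ = T Set.univ + 1 * ν Set.univ := by rw [hST, one_mul]; rfl
  have hSC : S C = 1 :=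
    (ENNReal.mul_left_inj (Measure.measure_univ_ne_zero.2 hν0) (measure_ne_top ν _)).1
      ((ENNReal.add_right_inj hTfin).1 hmass)
  rw [Kernel.Invariant, hSP, hSC, one_smul, ← hST]

theorem exists_invariant_of_residualKernel_drift [IsMarkovKernel P] (hν0 : ν ≠ 0) {W : E → ℝ≥0∞}
    (hW : ∀ x, ∫⁻ z, W z ∂(residualKernel P hC hν x) + 1 ≤ W x) (hνW : ∫⁻ x, W x ∂ν ≠ ⊤) :
    ∃ π : Measure E, IsProbabilityMeasure π ∧ P.Invariant π := by
  set S := greenMeasure (residualKernel P hC hν) ν with hS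
  have hfin : S Set.univ ≠ ⊤ := ne_top_of_le_ne_top hνW (greenMeasure_univ_le hW ν)
  have hinv : S.bind P = S := invariant_greenMeasure_residualKernel hC hν hν0 hfin
  have hνS : ν ≤ S := by
    rw [hS, greenMeasure_eq_add_bind]
    exact Measure.le_add_right le_rfl
  have hS0 : NeZero S := ⟨fun h0 => hν0 (le_antisymm (h0 ▸ hνS) (Measure.zero_le ν))⟩
  have : IsFiniteMeasure S := ⟨hfin.lt_top⟩
  refine ⟨(S Set.univ)⁻¹ • S, inferInstance, ?_⟩
  rw [Kernel.Invariant, Measure.comp_smul, hinv]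

end Residual

end InvariantMeasures

section PositiveHarrisChains

variable {E : Type*} [MeasurableSpace E]

/-- Every sublevel set of `V` is a small set of `P`, minorized by a multiple of the restriction
of `ψ` to that sublevel set. -/
def HasSmallSublevels (P : Kernel E E) (ψ : Measure E) (V : E → ℝ≥0) : Prop :=
  ∀ R : ℝ≥0, ∃ ε : ℝ≥0∞, ε ≠ 0 ∧ ∀ x, V x ≤ R → ε • ψ.restrict {y | V y ≤ R} ≤ P x

/-- The geometric drift condition of Foster and Lyapunov, `P V ≤ β V + b` with `β < 1`. -/
def HasGeometricDrift (P : Kernel E E) (V : E → ℝ≥0) : Prop :=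
  ∃ β b : ℝ≥0, β < 1 ∧ ∀ x, ∫⁻ z, V z ∂(P x) ≤ β * V x + b

/-- The kernel `P` is a strongly aperiodic, positive Harris recurrent kernel with maximal
irreducibility measure `ψ`. -/
def IsPositiveHarris (P : Kernel E E) [IsMarkovKernel P] (ψ : Measure E) : Prop :=
  IsPsiIrreducible P ψ ∧ IsStronglyAperiodic P ∧ IsHarrisRecurrent P ψ ∧
    IsPositiveRecurrent P ψ ∧ ∃ π : Measure E, IsProbabilityMeasure π ∧ P.Invariant π

variable {P : Kernel E E} {ψ : Measure E} {V : E → ℝ≥0}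

theorem exists_forall_ge_measure_inter_sublevel_ne_zero {A : Set E} (hA : ψ A ≠ 0) :
    ∃ R₀, ∀ R ≥ R₀, ψ (A ∩ {y | V y ≤ R}) ≠ 0 := by
  by_contra! hnull
  have hcover : A ⊆ ⋃ n : ℕ, A ∩ {y | V y ≤ n} := fun y hy =>
    Set.mem_iUnion.2 ((exists_nat_ge (V y)).imp fun n hn => ⟨hy, hn⟩)
  refine hA (measure_mono_null hcover (measure_iUnion_null fun n => ?_))
  obtain ⟨R, hR, hAR⟩ := hnull n
  exact measure_mono_null (Set.inter_subset_inter_right A fun y hy => le_trans hy hR) hAR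

theorem HasGeometricDrift.exists_forall_ge_drift (hdrift : HasGeometricDrift P V) :
    ∃ (R₀ : ℝ≥0) (b : ℝ≥0), ∀ R ≥ R₀, ∀ x,
      ∫⁻ z, V z ∂(P x) + 1 ≤ V x + {y | V y ≤ R}.indicator (fun _ => (b : ℝ≥0∞)) x := by
  obtain ⟨β, b, hβ, hV⟩ := hdrift
  refine ⟨(b + 1) / (1 - β), b + 1, fun R hR x => ?_⟩
  calc ∫⁻ z, V z ∂(P x) + 1 ≤ β * V x + b + 1 := by gcongr; exact hV x
    _ = ((β * V x + (b + 1) : ℝ≥0) : ℝ≥0∞) := by push_cast; ring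
    _ ≤ V x + {y | V y ≤ R}.indicator (fun _ => ((b + 1 : ℝ≥0) : ℝ≥0∞)) x := by
      by_cases hx : V x ≤ R
      · rw [Set.indicator_of_mem (by exact hx), ← ENNReal.coe_add]
        gcongr
        exact mul_le_of_le_one_left' hβ.le
      · rw [Set.indicator_of_notMem (by exact hx), add_zero]
        have hlarge : b + 1 ≤ (1 - β) * V x := by
          rw [← div_le_iff₀' (tsub_pos_of_lt hβ)]
          exact hR.trans (not_le.1 hx).le
        gcongr
        calc β * V x + (b + 1) ≤ β * V x + (1 - β) * V x := by gcongr
          _ = V x := by rw [← add_mul, add_tsub_cancel_of_le hβ.le, one_mul]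

theorem isMarkovKernel_pow [IsMarkovKernel P] (n : ℕ) : IsMarkovKernel (P ^ n) := by
  induction n with
  | zero => exact inferInstanceAs (IsMarkovKernel Kernel.id)
  | succ n ih => rw [pow_succ']; exact Kernel.IsMarkovKernel.comp P (P ^ n)

theorem HasGeometricDrift.exists_lintegral_pow_le [IsMarkovKernel P]
    (hdrift : HasGeometricDrift P V) (hVm : Measurable V) (x : E) :
    ∃ M : ℝ≥0, ∀ n, ∫⁻ z, V z ∂((P ^ n) x) ≤ M := by
  obtain ⟨β, b, hβ, hV⟩ := hdrift
  have hVm' : Measurable fun z => (V z : ℝ≥0∞) := hVm.coe_nnreal_ennreal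
  set M : ℝ≥0 := max (V x) (b / (1 - β))
  have hM : β * M + b ≤ M := by
    calc β * M + b ≤ β * M + (1 - β) * M := by
          gcongr
          rw [← div_le_iff₀' (tsub_pos_of_lt hβ)]
          exact le_max_right _ _
      _ = M := by rw [← add_mul, add_tsub_cancel_of_le hβ.le, one_mul]
  refine ⟨M, fun n => ?_⟩
  induction n with
  | zero =>
    calc ∫⁻ z, V z ∂((P ^ 0) x) = V x := lintegral_dirac' x hVm'
      _ ≤ M := by exact_mod_cast le_max_left _ _
  | succ n ih =>
    have := isMarkovKernel_pow (P := P) n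
    calc ∫⁻ z, V z ∂((P ^ (n + 1)) x) = ∫⁻ y, ∫⁻ z, V z ∂(P y) ∂((P ^ n) x) := by
          rw [pow_succ']; exact Kernel.lintegral_comp P (P ^ n) x hVm'
      _ ≤ ∫⁻ y, (β * V y + b) ∂((P ^ n) x) := lintegral_mono hV
      _ = β * ∫⁻ y, V y ∂((P ^ n) x) + b := by
          rw [lintegral_add_right _ measurable_const, lintegral_const_mul _ hVm', lintegral_const,
            measure_univ, mul_one]
      _ ≤ β * M + b := by gcongr
      _ ≤ M := by exact_mod_cast hM

theorem half_le_measure_of_compl_le {μ : Measure E} [IsProbabilityMeasure μ] {K : Set E}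
    (hK : MeasurableSet K) (htail : μ Kᶜ ≤ 2⁻¹) : 2⁻¹ ≤ μ K := by
  refine ENNReal.le_of_add_le_add_right (a := 2⁻¹) (by simp) ?_
  calc (2⁻¹ + 2⁻¹ : ℝ≥0∞) = μ K + μ Kᶜ := by
        rw [ENNReal.inv_two_add_inv_two, prob_add_prob_compl hK]
    _ ≤ μ K + 2⁻¹ := by gcongr

theorem half_le_measure_sublevel {μ : Measure E} [IsProbabilityMeasure μ] (hVm : Measurable V)
    {M R : ℝ≥0} (hM : ∫⁻ y, V y ∂μ ≤ M) (hMR : 2 * M ≤ R) (hR : R ≠ 0) :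
    2⁻¹ ≤ μ {y | V y ≤ R} := by
  have htail : μ {y | V y ≤ R}ᶜ ≤ 2⁻¹ := by
    calc μ {y | V y ≤ R}ᶜ ≤ μ {y | (R : ℝ≥0∞) ≤ V y} :=
          measure_mono fun y hy => ENNReal.coe_le_coe.2 (lt_of_not_ge fun h => hy h).le
      _ ≤ (∫⁻ y, V y ∂μ) / R :=
          meas_ge_le_lintegral_div hVm.coe_nnreal_ennreal.aemeasurable
            (ENNReal.coe_ne_zero.2 hR) ENNReal.coe_ne_top
      _ ≤ 2⁻¹ := by
          refine ENNReal.div_le_of_le_mul (hM.trans ?_)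
          rw [mul_comm, ← div_eq_mul_inv, ENNReal.le_div_iff_mul_le (by simp) (by simp), mul_comm]
          exact_mod_cast hMR
  exact half_le_measure_of_compl_le (measurableSet_le hVm measurable_const) htail

namespace HasSmallSublevels

theorem exists_forall_ge_le_apply (hsmall : HasSmallSublevels P ψ V) {A : Set E}
    (hA : MeasurableSet A) (hψA : ψ A ≠ 0) :
    ∃ R₀ : ℝ≥0, ∀ R ≥ R₀, ∃ δ : ℝ≥0∞, δ ≠ 0 ∧ ∀ x, V x ≤ R → δ ≤ P x A := by
  obtain ⟨R₀, hR₀⟩ := exists_forall_ge_measure_inter_sublevel_ne_zero (V := V) hψA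
  refine ⟨R₀, fun R hR => ?_⟩
  obtain ⟨ε, hε, hmin⟩ := hsmall R
  refine ⟨ε * ψ (A ∩ {y | V y ≤ R}), mul_ne_zero hε (hR₀ R hR), fun x hx => ?_⟩
  simpa only [Measure.smul_apply, Measure.restrict_apply hA, smul_eq_mul] using hmin x hx A

theorem measure_sublevel_lt_top [IsMarkovKernel P] (hsmall : HasSmallSublevels P ψ V) (R : ℝ≥0) :
    ψ {y | V y ≤ R} < ⊤ := by
  obtain ⟨ε, hε, hmin⟩ := hsmall R
  obtain hempty | ⟨x, hx⟩ := {y | V y ≤ R}.eq_empty_or_nonempty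
  · simp [hempty]
  · have hmass : ε * ψ {y | V y ≤ R} ≤ 1 := by
      simpa only [Measure.smul_apply, Measure.restrict_apply_univ, smul_eq_mul, measure_univ]
        using hmin x hx Set.univ
    exact ENNReal.lt_top_of_mul_ne_top_right (ne_top_of_le_ne_top ENNReal.one_ne_top hmass) hε

theorem sigmaFinite [IsMarkovKernel P] (hsmall : HasSmallSublevels P ψ V) : SigmaFinite ψ :=
  ⟨⟨{ set := fun n => {y | V y ≤ n}
      set_mem := fun _ => trivial
      finite := fun n => hsmall.measure_sublevel_lt_top n
      spanning := Set.eq_univ_of_forall fun y => Set.mem_iUnion.2 (exists_nat_ge (V y)) }⟩⟩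

theorem isPsiIrreducible [IsMarkovKernel P] (hsmall : HasSmallSublevels P ψ V) (hψ : ψ ≠ 0)
    (hac : ∀ x, P x ≪ ψ) : IsPsiIrreducible P ψ := by
  refine ⟨hψ, hsmall.sigmaFinite, fun x A hA hψA => ?_, fun φ hφ => .mk fun A hA hψA => ?_⟩
  · obtain ⟨R₀, hR₀⟩ := hsmall.exists_forall_ge_le_apply hA hψA.ne'
    obtain ⟨δ, hδ, hδA⟩ := hR₀ _ (le_max_left R₀ (V x))
    exact ⟨1, one_pos, (pos_iff_ne_zero.2 hδ).trans_le
      (by simpa only [pow_one] using hδA x (le_max_right _ _))⟩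
  · by_contra hφA
    obtain ⟨x, -⟩ := nonempty_of_measure_ne_zero hφA
    obtain ⟨n, hn, hpos⟩ := hφ x A hA (pos_iff_ne_zero.2 hφA)
    obtain ⟨n, rfl⟩ := Nat.exists_eq_succ_of_ne_zero hn.ne'
    refine hpos.ne' ?_
    rw [Kernel.pow_succ_apply_eq_lintegral P n x hA]
    simp only [hac _ hψA, lintegral_zero]

theorem isStronglyAperiodic (hsmall : HasSmallSublevels P ψ V) (hVm : Measurable V)
    (hψ : ψ ≠ 0) : IsStronglyAperiodic P := by
  obtain ⟨R, hR⟩ := exists_forall_ge_measure_inter_sublevel_ne_zero (V := V)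
    (Measure.measure_univ_ne_zero.2 hψ)
  obtain ⟨ε, hε, hmin⟩ := hsmall R
  refine ⟨{y | V y ≤ R}, ε • ψ.restrict {y | V y ≤ R}, measurableSet_le hVm measurable_const, ?_,
    fun x hx B _ => hmin x hx B⟩
  rw [Measure.smul_apply, Measure.restrict_apply_self, smul_eq_mul]
  exact ENNReal.mul_pos hε (by simpa only [Set.univ_inter] using hR R le_rfl)

variable [IsMarkovKernel P]

theorem isHarrisRecurrent (hsmall : HasSmallSublevels P ψ V) (hdrift : HasGeometricDrift P V) :
    IsHarrisRecurrent P ψ := by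
  intro A hA hψA x _
  obtain ⟨R₁, b, hb⟩ := hdrift.exists_forall_ge_drift
  obtain ⟨R₂, hR₂⟩ := hsmall.exists_forall_ge_le_apply hA hψA.ne'
  obtain ⟨δ, hδ, hδA⟩ := hR₂ _ (le_max_right R₁ R₂)
  set K := {y | V y ≤ max R₁ R₂}
  let Q := P.restrict hA.compl
  have hmass (x : E) : K.indicator (fun _ => δ) x + Q x Set.univ ≤ 1 := by
    calc K.indicator (fun _ => δ) x + Q x Set.univ ≤ P x A + P x Aᶜ := by
          rw [Kernel.restrict_apply, Measure.restrict_apply_univ]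
          gcongr
          exact Set.indicator_le' (fun x hx => hδA x hx) (fun _ _ => zero_le) x
      _ = 1 := prob_add_prob_compl hA
  have hexit (x : E) : ∫⁻ z, V z ∂(Q x) + 1 ≤ V x + K.indicator (fun _ => (b : ℝ≥0∞)) x := by
    refine le_trans ?_ (hb _ (le_max_left R₁ R₂) x)
    gcongr
    exact Measure.restrict_le_self
  exact chainLaw_visits_eq_top hA (fun z => tendsto_followProb_of_restrict_drift hA.compl
    (drift_add_const hδ hmass hexit)
    (ENNReal.add_ne_top.2 ⟨ENNReal.coe_ne_top, ENNReal.div_ne_top ENNReal.coe_ne_top hδ⟩)) x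

theorem isPositiveRecurrent (hsmall : HasSmallSublevels P ψ V) (hdrift : HasGeometricDrift P V)
    (hVm : Measurable V) : IsPositiveRecurrent P ψ := by
  intro A hA hψA x _
  obtain ⟨M, hM⟩ := hdrift.exists_lintegral_pow_le hVm x
  obtain ⟨R₀, hR₀⟩ := hsmall.exists_forall_ge_le_apply hA hψA.ne'
  set R := max R₀ (2 * M + 1)
  obtain ⟨δ, hδ, hδA⟩ := hR₀ R (le_max_left _ _)
  have hK : MeasurableSet {y | V y ≤ R} := measurableSet_le hVm measurable_const
  have htight (n : ℕ) : 2⁻¹ ≤ (P ^ n) x {y | V y ≤ R} := by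
    have := isMarkovKernel_pow (P := P) n
    exact half_le_measure_sublevel hVm (hM n)
      ((le_add_of_nonneg_right zero_le_one).trans (le_max_right _ _)) (by positivity)
  have hfreq (n : ℕ) : δ * 2⁻¹ ≤ (P ^ (n + 1)) x A := by
    calc δ * 2⁻¹ ≤ δ * (P ^ n) x {y | V y ≤ R} := by gcongr; exact htight n
      _ = ∫⁻ _ in {y | V y ≤ R}, δ ∂((P ^ n) x) := (setLIntegral_const _ _).symm
      _ ≤ ∫⁻ y in {y | V y ≤ R}, P y A ∂((P ^ n) x) := setLIntegral_mono' hK hδA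
      _ ≤ ∫⁻ y, P y A ∂((P ^ n) x) := setLIntegral_le_lintegral _ _
      _ = (P ^ (n + 1)) x A := (Kernel.pow_succ_apply_eq_lintegral P n x hA).symm
  calc 0 < δ * 2⁻¹ := ENNReal.mul_pos hδ (by simp)
    _ ≤ limsup (fun n => (P ^ n) x A) atTop := by
      rw [← limsup_nat_add _ 1]
      exact le_limsup_of_frequently_le (Frequently.of_forall hfreq)

theorem exists_invariant (hsmall : HasSmallSublevels P ψ V) (hdrift : HasGeometricDrift P V)
    (hVm : Measurable V) (hψ : ψ ≠ 0) :
    ∃ π : Measure E, IsProbabilityMeasure π ∧ P.Invariant π := by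
  obtain ⟨R₁, b, hb⟩ := hdrift.exists_forall_ge_drift
  obtain ⟨R₂, hR₂⟩ := exists_forall_ge_measure_inter_sublevel_ne_zero (V := V)
    (Measure.measure_univ_ne_zero.2 hψ)
  set R := max R₁ R₂
  set C := {y | V y ≤ R}
  have hC : MeasurableSet C := measurableSet_le hVm measurable_const
  have hψC : ψ C ≠ 0 := by simpa only [Set.univ_inter] using hR₂ R (le_max_right _ _)
  obtain ⟨ε, hε, hmin⟩ := hsmall R
  obtain ⟨x₀, hx₀⟩ := nonempty_of_measure_ne_zero hψC
  set ν := ε • ψ.restrict C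
  have hν (x) (hx : x ∈ C) : ν ≤ P x := hmin x hx
  have : IsFiniteMeasure ν := isFiniteMeasure_of_le _ (hν x₀ hx₀)
  have hν0 : ν Set.univ ≠ 0 := by
    simpa only [ν, Measure.smul_apply, Measure.restrict_apply_univ, smul_eq_mul] using
      mul_ne_zero hε hψC
  have hV (x : E) : ∫⁻ z, V z ∂(residualKernel P hC hν x) + 1 ≤
      V x + C.indicator (fun _ => (b : ℝ≥0∞)) x := by
    refine le_trans ?_ (hb R (le_max_left _ _) x)
    gcongr
    exact residualKernel_le hC hν x
  refine exists_invariant_of_residualKernel_drift hC hν (Measure.measure_univ_ne_zero.1 hν0)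
    (drift_add_const hν0 (fun x => (indicator_add_residualKernel_univ hC hν x).le) hV) ?_
  obtain ⟨M, hM⟩ := hdrift.exists_lintegral_pow_le hVm x₀
  have hνV : ∫⁻ y, V y ∂ν ≤ M :=
    (lintegral_mono' (hν x₀ hx₀) le_rfl).trans (by simpa only [pow_one] using hM 1)
  rw [lintegral_add_right _ measurable_const, lintegral_const,
    ENNReal.div_mul_cancel hν0 (measure_ne_top ν _)]
  exact ENNReal.add_ne_top.2 ⟨ne_top_of_le_ne_top ENNReal.coe_ne_top hνV, ENNReal.coe_ne_top⟩

theorem isPositiveHarris (hsmall : HasSmallSublevels P ψ V) (hdrift : HasGeometricDrift P V)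
    (hVm : Measurable V) (hψ : ψ ≠ 0) (hac : ∀ x, P x ≪ ψ) : IsPositiveHarris P ψ :=
  ⟨hsmall.isPsiIrreducible hψ hac, hsmall.isStronglyAperiodic hVm hψ,
    hsmall.isHarrisRecurrent hdrift, hsmall.isPositiveRecurrent hdrift hVm,
    hsmall.exists_invariant hdrift hVm hψ⟩

end HasSmallSublevels

end PositiveHarrisChains

section Minorization

theorem smul_le_bind {X E : Type*} [MeasurableSpace X] [MeasurableSpace E] {ν : Measure X}
    {κ : X → Measure E} (hκ : Measurable κ) {K : Set X} (hK : MeasurableSet K) {η : Measure E}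
    (hη : ∀ u ∈ K, η ≤ κ u) : ν K • η ≤ ν.bind κ := by
  refine Measure.le_iff.2 fun s hs => ?_
  calc (ν K • η) s = ∫⁻ _ in K, η s ∂ν := by
        rw [setLIntegral_const, Measure.smul_apply, smul_eq_mul, mul_comm]
    _ ≤ ∫⁻ u in K, κ u s ∂ν := setLIntegral_mono' hK fun u hu => hη u hu s
    _ ≤ ∫⁻ u, κ u s ∂ν := setLIntegral_le_lintegral _ _
    _ = ν.bind κ s := (Measure.bind_apply hs hκ.aemeasurable).symm

theorem restrict_map_le_map_restrict {X E : Type*} [MeasurableSpace X] [MeasurableSpace E]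
    {m : Measure X} {f : X → E} (hf : Measurable f) {K : Set E} (hK : MeasurableSet K) {K' : Set X}
    (hKK' : f ⁻¹' K ⊆ K') : (m.map f).restrict K ≤ (m.restrict K').map f := by
  rw [Measure.restrict_map hf hK]
  exact Measure.map_mono (Measure.restrict_mono_set m hKK') hf

theorem smul_restrict_le_withDensity {X : Type*} [MeasurableSpace X] {m : Measure X} {K : Set X}
    (hK : MeasurableSet K) {p : X → ℝ≥0∞} {c : ℝ≥0∞} (hc : ∀ t ∈ K, c ≤ p t) :
    c • m.restrict K ≤ m.withDensity p := by
  rw [← withDensity_const, ← withDensity_indicator hK]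
  exact withDensity_mono (Eventually.of_forall
    (Set.indicator_le fun t ht => hc t ht))

/-- On every ball around the origin, the measures `κ x` dominate a common multiple of the
restriction of `m` to that ball. -/
def MinorizedOnBalls {X E : Type*} [Norm X] [NormedAddCommGroup E] [MeasurableSpace E]
    (m : Measure E) (κ : X → Measure E) : Prop :=
  ∀ R : ℝ, ∃ ε : ℝ≥0∞, ε ≠ 0 ∧
    ∀ x, ‖x‖ ≤ R → ε • m.restrict (Metric.closedBall 0 R) ≤ κ x

section Tightness

variable {E : Type*} [NormedAddCommGroup E] [MeasurableSpace E] [BorelSpace E]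
  [SecondCountableTopology E]

theorem mul_measure_compl_closedBall_le_conv (ν₁ ν₂ : Measure E) [SFinite ν₂] (a r : ℝ) :
    ν₁ (Metric.closedBall 0 a) * ν₂ (Metric.closedBall 0 (a + r))ᶜ ≤ (ν₁ ∗ ν₂) {u | r ≤ ‖u‖} := by
  have hmeas : MeasurableSet {u : E | r ≤ ‖u‖} := measurableSet_le measurable_const measurable_norm
  rw [← Measure.prod_prod, Measure.conv, Measure.map_apply measurable_add hmeas]
  refine measure_mono fun q ⟨hq₁, hq₂⟩ => ?_
  have hnorm₁ : ‖q.1‖ ≤ a := by simpa using hq₁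
  have hnorm₂ : a + r < ‖q.2‖ := by simpa using hq₂
  have htriangle : ‖q.2‖ ≤ ‖q.1 + q.2‖ + ‖q.1‖ := by simpa using norm_sub_le (q.1 + q.2) q.1
  change r ≤ ‖q.1 + q.2‖
  linarith

theorem exists_half_le_closedBall_of_conv {v q : ℝ≥0∞} (hv : v ≠ ⊤) (hq : q ≠ 0) (a : ℝ) :
    ∃ r : ℝ, ∀ ν₁ ν₂ : Measure E, IsProbabilityMeasure ν₂ →
      ∫⁻ u, ‖u‖ₑ ^ 2 ∂(ν₁ ∗ ν₂) ≤ v → q ≤ ν₁ (Metric.closedBall 0 a) →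
        2⁻¹ ≤ ν₂ (Metric.closedBall 0 r) := by
  obtain ⟨n, hn⟩ :=
    ENNReal.exists_nat_mul_gt hq (ENNReal.mul_ne_top hv (ENNReal.ofNat_ne_top (n := 2)))
  refine ⟨a + n, fun ν₁ ν₂ _ hmoment hcharge => ?_⟩
  refine half_le_measure_of_compl_le measurableSet_closedBall ?_
  have hsq (u : E) (hu : (n : ℝ) ≤ ‖u‖) : (n : ℝ≥0∞) ≤ ‖u‖ₑ ^ 2 := by
    calc (n : ℝ≥0∞) ≤ (n : ℝ≥0∞) ^ 2 := by exact_mod_cast Nat.le_self_pow two_ne_zero n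
      _ ≤ ‖u‖ₑ ^ 2 := by
        gcongr
        rw [← ofReal_norm, ← ENNReal.ofReal_natCast]
        exact ENNReal.ofReal_le_ofReal hu
  have htail : n * (q * ν₂ (Metric.closedBall 0 (a + n))ᶜ) ≤ v := by
    calc n * (q * ν₂ (Metric.closedBall 0 (a + n))ᶜ)
        ≤ n * (ν₁ (Metric.closedBall 0 a) * ν₂ (Metric.closedBall 0 (a + n))ᶜ) := by gcongr
      _ ≤ n * (ν₁ ∗ ν₂) {u | (n : ℝ≥0∞) ≤ ‖u‖ₑ ^ 2} := by
        gcongr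
        exact (mul_measure_compl_closedBall_le_conv ν₁ ν₂ a n).trans (measure_mono hsq)
      _ ≤ ∫⁻ u, ‖u‖ₑ ^ 2 ∂(ν₁ ∗ ν₂) := mul_meas_ge_le_lintegral (by fun_prop) _
      _ ≤ v := hmoment
  by_contra! hlarge
  refine hn.not_ge ?_
  calc (n : ℝ≥0∞) * q = n * (q * 2⁻¹) * 2 := by
        rw [mul_assoc, mul_assoc, ENNReal.inv_mul_cancel (by simp) (by simp), mul_one]
    _ ≤ n * (q * ν₂ (Metric.closedBall 0 (a + n))ᶜ) * 2 := by gcongr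
    _ ≤ v * 2 := by gcongr

end Tightness

theorem smul_restrict_closedBall_le_map_const_add {E : Type*} [NormedAddCommGroup E]
    [MeasurableSpace E] [BorelSpace E] {m ν : Measure E} [m.IsAddLeftInvariant] {ε : ℝ≥0∞}
    {R r : ℝ} (hν : ε • m.restrict (Metric.closedBall 0 (R + r)) ≤ ν) {u : E} (hu : ‖u‖ ≤ r) :
    ε • m.restrict (Metric.closedBall 0 R) ≤ ν.map (fun t => u + t) := by
  have hsub : (fun t => u + t) ⁻¹' Metric.closedBall 0 R ⊆ Metric.closedBall 0 (R + r) := by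
    intro t ht
    have ht' : ‖u + t‖ ≤ R := mem_closedBall_zero_iff.1 ht
    have htriangle : ‖t‖ ≤ ‖u + t‖ + ‖u‖ := by simpa using norm_sub_le (u + t) u
    rw [mem_closedBall_zero_iff]
    linarith
  have hu_add : Measurable fun t : E => u + t := measurable_const_add u
  calc ε • m.restrict (Metric.closedBall 0 R)
      = ε • (m.map (fun t => u + t)).restrict (Metric.closedBall 0 R) := by
        rw [map_add_left_eq_self]
    _ ≤ ε • (m.restrict (Metric.closedBall 0 (R + r))).map (fun t => u + t) := by
        gcongr
        exact restrict_map_le_map_restrict hu_add measurableSet_closedBall hsub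
    _ = (ε • m.restrict (Metric.closedBall 0 (R + r))).map (fun t => u + t) :=
        (Measure.map_smul _ _ _).symm
    _ ≤ ν.map (fun t => u + t) := Measure.map_mono hν hu_add

namespace MinorizedOnBalls

variable {X E : Type*} [Norm X] [NormedAddCommGroup E] [MeasurableSpace E] {m : Measure E}

theorem comp {Y : Type*} [Norm Y] {κ : X → Measure E} (hκ : MinorizedOnBalls m κ) {h : Y → X}
    (hh : ∀ y, ‖h y‖ ≤ ‖y‖) : MinorizedOnBalls m fun y => κ (h y) := fun R =>
  let ⟨ε, hε, hmin⟩ := hκ R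
  ⟨ε, hε, fun y hy => hmin (h y) ((hh y).trans hy)⟩

theorem exists_smul_restrict_le {κ : X → Measure E} (hκ : MinorizedOnBalls m κ) (R r : ℝ) :
    ∃ ε : ℝ≥0∞, ε ≠ 0 ∧ ∀ x, ‖x‖ ≤ R → ε • m.restrict (Metric.closedBall 0 r) ≤ κ x := by
  obtain ⟨ε, hε, hmin⟩ := hκ (max R r)
  refine ⟨ε, hε, fun x hx => le_trans ?_ (hmin x (hx.trans (le_max_left _ _)))⟩
  gcongr
  exact le_max_right _ _

variable [m.IsOpenPosMeasure]

theorem exists_le_measure_closedBall {κ : X → Measure E} (hκ : MinorizedOnBalls m κ) (R : ℝ)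
    {r : ℝ} (hr : 0 < r) :
    ∃ q : ℝ≥0∞, q ≠ 0 ∧ ∀ x, ‖x‖ ≤ R → q ≤ κ x (Metric.closedBall 0 r) := by
  obtain ⟨ε, hε, hmin⟩ := hκ.exists_smul_restrict_le R r
  refine ⟨ε * m (Metric.closedBall 0 r), mul_ne_zero hε
    (Metric.measure_closedBall_pos m 0 hr).ne', fun x hx => ?_⟩
  simpa only [Measure.smul_apply, Measure.restrict_apply_self, smul_eq_mul] using
    hmin x hx (Metric.closedBall 0 r)

variable [BorelSpace E]

theorem bind {κ₁ : X → Measure E} {κ₂ : X × E → Measure E} (h₁ : MinorizedOnBalls m κ₁)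
    (h₂ : MinorizedOnBalls m κ₂) (hκ₂ : ∀ x, Measurable fun y => κ₂ (x, y)) :
    MinorizedOnBalls m fun x => (κ₁ x).bind fun y => κ₂ (x, y) := by
  intro R
  obtain ⟨q, hq, hqκ₁⟩ := h₁.exists_le_measure_closedBall R one_pos
  obtain ⟨ε, hε, hmin⟩ := h₂.exists_smul_restrict_le (max R 1) R
  refine ⟨q * ε, mul_ne_zero hq hε, fun x hx => ?_⟩
  calc (q * ε) • m.restrict (Metric.closedBall 0 R)
      = q • ε • m.restrict (Metric.closedBall 0 R) := mul_smul _ _ _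
    _ ≤ κ₁ x (Metric.closedBall 0 1) • ε • m.restrict (Metric.closedBall 0 R) := by
        gcongr
        exact hqκ₁ x hx
    _ ≤ (κ₁ x).bind fun y => κ₂ (x, y) :=
        smul_le_bind (hκ₂ x) measurableSet_closedBall fun y hy =>
          hmin (x, y) (max_le_max hx (mem_closedBall_zero_iff.1 hy))

theorem conv [SecondCountableTopology E] [m.IsAddLeftInvariant] {νa νb : X → Measure E}
    (hνa : MinorizedOnBalls m νa) (hνa' : ∀ x, IsProbabilityMeasure (νa x))
    (hνb : ∀ x, IsProbabilityMeasure (νb x)) {v : ℝ≥0∞} (hv : v ≠ ⊤)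
    (hmoment : ∀ x, ∫⁻ u, ‖u‖ₑ ^ 2 ∂(νa x ∗ νb x) ≤ v) :
    MinorizedOnBalls m fun x => νa x ∗ νb x := by
  intro R
  obtain ⟨q, hq, hqν⟩ := hνa.exists_le_measure_closedBall R one_pos
  obtain ⟨r, hr⟩ := exists_half_le_closedBall_of_conv (E := E) hv hq 1
  obtain ⟨ε, hε, hmin⟩ := hνa.exists_smul_restrict_le R (R + r)
  refine ⟨2⁻¹ * ε, mul_ne_zero (by simp) hε, fun x hx => ?_⟩
  have hadd : Measurable (Function.uncurry fun u t : E => u + t) := measurable_add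
  have htranslate (u : E) (hu : u ∈ Metric.closedBall 0 r) :
      ε • m.restrict (Metric.closedBall 0 R) ≤ randomMapKernel (νa x) (fun u t => u + t) u := by
    rw [randomMapKernel_apply _ hadd]
    exact smul_restrict_closedBall_le_map_const_add (hmin x hx) (mem_closedBall_zero_iff.1 hu)
  have hconv : νa x ∗ νb x = (νb x).bind (randomMapKernel (νa x) fun u t => u + t) := by
    rw [bind_randomMapKernel _ _ hadd, Measure.conv_comm]
    rfl
  calc (2⁻¹ * ε) • m.restrict (Metric.closedBall 0 R)
      = (2⁻¹ : ℝ≥0∞) • ε • m.restrict (Metric.closedBall 0 R) := mul_smul _ _ _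
    _ ≤ νb x (Metric.closedBall 0 r) • ε • m.restrict (Metric.closedBall 0 R) := by
        gcongr
        exact hr _ _ (hνb x) (hmoment x) (hqν x hx)
    _ ≤ νa x ∗ νb x := by
        rw [hconv]
        exact smul_le_bind (Kernel.measurable _) measurableSet_closedBall htranslate

end MinorizedOnBalls

section Affine

variable {E : Type*} [NormedAddCommGroup E] [NormedSpace ℝ E] [FiniteDimensional ℝ E]
  [MeasurableSpace E] [BorelSpace E] {m : Measure E} [m.IsAddHaarMeasure] {τ : ℝ}

theorem map_sub_smul_eq_smul (hτ : τ ≠ 0) (c : E) :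
    m.map (fun u => c - τ • u) = ENNReal.ofReal |((-τ) ^ Module.finrank ℝ E)⁻¹| • m := by
  have hsplit : (fun u => c - τ • u) = (fun u => c + u) ∘ fun u => (-τ) • u := by
    ext u
    simp [sub_eq_add_neg]
  rw [hsplit, ← Measure.map_map (measurable_const_add c) (measurable_const_smul (-τ)),
    Measure.map_addHaar_smul m (neg_ne_zero.2 hτ), Measure.map_smul, map_add_left_eq_self]

theorem map_sub_smul_absolutelyContinuous (hτ : τ ≠ 0) (c : E) {ν : Measure E} (hν : ν ≪ m) :
    ν.map (fun u => c - τ • u) ≪ m :=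
  (hν.map (by fun_prop)).trans
    ((map_sub_smul_eq_smul hτ c).le.absolutelyContinuous.trans Measure.smul_absolutelyContinuous)

theorem MinorizedOnBalls.map_sub_smul {X : Type*} [Norm X] {κ : X → Measure E}
    (hκ : MinorizedOnBalls m κ) (hτ : τ ≠ 0) {c : X → E}
    (hc : ∀ R, ∃ M, ∀ x, ‖x‖ ≤ R → ‖c x‖ ≤ M) :
    MinorizedOnBalls m fun x => (κ x).map fun u => c x - τ • u := by
  intro R
  obtain ⟨M, hM⟩ := hc R
  obtain ⟨ε, hε, hmin⟩ := hκ.exists_smul_restrict_le R ((M + R) / |τ|)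
  set s := ENNReal.ofReal |((-τ) ^ Module.finrank ℝ E)⁻¹|
  have hs : s ≠ 0 := by
    have : 0 < |((-τ) ^ Module.finrank ℝ E)⁻¹| := abs_pos.2 (by simp [hτ])
    exact (ENNReal.ofReal_pos.2 this).ne'
  refine ⟨ε * s, mul_ne_zero hε hs, fun x hx => ?_⟩
  have haffine : Measurable fun u => c x - τ • u := by fun_prop
  have hpre : (fun u => c x - τ • u) ⁻¹' Metric.closedBall 0 R ⊆
      Metric.closedBall 0 ((M + R) / |τ|) := by
    intro u hu
    have hu' : ‖c x - τ • u‖ ≤ R := mem_closedBall_zero_iff.1 hu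
    rw [mem_closedBall_zero_iff, le_div_iff₀' (abs_pos.2 hτ), ← Real.norm_eq_abs, ← norm_smul]
    linarith [hM x hx, norm_le_norm_add_norm_sub' (τ • u) (c x),
      norm_sub_rev (τ • u) (c x)]
  calc (ε * s) • m.restrict (Metric.closedBall 0 R)
      = ε • (m.map fun u => c x - τ • u).restrict (Metric.closedBall 0 R) := by
        rw [map_sub_smul_eq_smul hτ, Measure.restrict_smul, mul_smul]
    _ ≤ ε • (m.restrict (Metric.closedBall 0 ((M + R) / |τ|))).map fun u => c x - τ • u := by
        gcongr
        exact restrict_map_le_map_restrict haffine measurableSet_closedBall hpre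
    _ = (ε • m.restrict (Metric.closedBall 0 ((M + R) / |τ|))).map fun u => c x - τ • u :=
        (Measure.map_smul _ _ _).symm
    _ ≤ (κ x).map fun u => c x - τ • u := Measure.map_mono (hmin x hx) haffine

end Affine

theorem MinorizedOnBalls.hasSmallSublevels {E : Type*} [NormedAddCommGroup E] [MeasurableSpace E]
    {m : Measure E} {P : Kernel E E} (hP : MinorizedOnBalls m P) (xs : E) :
    HasSmallSublevels P m fun x => ‖x - xs‖₊ ^ 2 := by
  intro R
  obtain ⟨ε, hε, hmin⟩ := hP (√R + ‖xs‖)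
  have hball (x : E) (hx : ‖x - xs‖₊ ^ 2 ≤ R) : ‖x‖ ≤ √R + ‖xs‖ := by
    have hdist : ‖x - xs‖ ≤ √R := Real.le_sqrt_of_sq_le (by exact_mod_cast hx)
    linarith [norm_le_norm_sub_add x xs]
  refine ⟨ε, hε, fun x hx => le_trans ?_ (hmin x (hball x hx))⟩
  gcongr
  exact fun y hy => mem_closedBall_zero_iff.2 (hball y hy)

end Minorization

section Noise

variable {d : ℕ} {Ω S : Type*} [MeasurableSpace Ω] {Pr : Measure Ω}
  {ξ : ℕ → Ω → S} {U : EuclideanSpace ℝ (Fin d) → S → EuclideanSpace ℝ (Fin d)} {σ : ℝ}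

theorem HasPositiveDensityPart.exists_conv_eq_map [IsProbabilityMeasure Pr]
    (hd : HasPositiveDensityPart Pr ξ U) :
    ∃ νa νb : EuclideanSpace ℝ (Fin d) → Measure (EuclideanSpace ℝ (Fin d)),
      (∀ x, IsProbabilityMeasure (νa x)) ∧ (∀ x, IsProbabilityMeasure (νb x)) ∧
      (∀ x, Pr.map (fun ω => U x (ξ 0 ω)) = νa x ∗ νb x) ∧ (∀ x, νa x ≪ volume) ∧
      MinorizedOnBalls volume νa := by
  obtain ⟨p, -, hp, hinf⟩ := hd
  choose Ua Ub hUa hUb hindep hsum hlaw using hp 0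
  refine ⟨fun x => Pr.map (Ua x), fun x => Pr.map (Ub x),
    fun x => Measure.isProbabilityMeasure_map (hUa x).aemeasurable,
    fun x => Measure.isProbabilityMeasure_map (hUb x).aemeasurable, fun x => ?_, fun x => ?_,
    fun R => ?_⟩
  · rw [← (hindep x).map_add_eq_map_conv_map (hUa x) (hUb x)]
    exact congrArg (Pr.map ·) (funext (hsum x))
  · exact (hlaw x).le.absolutelyContinuous.trans (withDensity_absolutelyContinuous _ _)
  · set K := Metric.closedBall (0 : EuclideanSpace ℝ (Fin d)) R
    refine ⟨⨅ x ∈ K, ⨅ t ∈ K, p x t,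
      (hinf K K Metric.isBounded_closedBall Metric.isBounded_closedBall).ne', fun x hx => ?_⟩
    dsimp only
    rw [hlaw]
    exact smul_restrict_le_withDensity measurableSet_closedBall fun t ht =>
      (iInf₂_le x (mem_closedBall_zero_iff.2 hx)).trans (iInf₂_le t ht)

variable [MeasurableSpace S]

/-- The random fields `x ↦ U x (ξ k ·)` are i.i.d. with second moments at most `σ ^ 2`: this is
`IsNoise` for fields which may be biased. -/
structure HasSquareIntegrableNoise (Pr : Measure Ω) (ξ : ℕ → Ω → S)
    (U : EuclideanSpace ℝ (Fin d) → S → EuclideanSpace ℝ (Fin d)) (σ : ℝ) : Prop where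
  measurable_field : Measurable (Function.uncurry U)
  measurable_seed : ∀ k, Measurable (ξ k)
  indep : iIndepFun ξ Pr
  ident : ∀ k, IdentDistrib (ξ k) (ξ 0) Pr Pr
  second_moment : ∀ k x, ∫⁻ ω, ‖U x (ξ k ω)‖ₑ ^ 2 ∂Pr ≤ ENNReal.ofReal (σ ^ 2)

theorem IsNoise.hasSquareIntegrableNoise (hU : IsNoise Pr ξ U σ) :
    HasSquareIntegrableNoise Pr ξ U σ :=
  ⟨hU.measurable_field, hU.measurable_seed, hU.indep, hU.ident, hU.second_moment⟩

namespace HasSquareIntegrableNoise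

variable (hU : HasSquareIntegrableNoise Pr ξ U σ)
include hU

theorem lintegral_seed (x : EuclideanSpace ℝ (Fin d)) :
    ∫⁻ s, ‖U x s‖ₑ ^ 2 ∂(Pr.map (ξ 0)) ≤ ENNReal.ofReal (σ ^ 2) := by
  have hUx : Measurable (U x) := hU.measurable_field.of_uncurry_left
  rw [lintegral_map (by fun_prop) (hU.measurable_seed 0)]
  exact hU.second_moment 0 x

theorem map_seed_map (x : EuclideanSpace ℝ (Fin d)) :
    (Pr.map (ξ 0)).map (U x) = Pr.map fun ω => U x (ξ 0 ω) :=
  Measure.map_map hU.measurable_field.of_uncurry_left (hU.measurable_seed 0)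

variable [IsProbabilityMeasure Pr] (hd : HasPositiveDensityPart Pr ξ U)
include hd

theorem map_seed_map_absolutelyContinuous (x : EuclideanSpace ℝ (Fin d)) :
    (Pr.map (ξ 0)).map (U x) ≪ volume := by
  obtain ⟨νa, νb, hνa, hνb, hconv, hac, -⟩ := hd.exists_conv_eq_map
  rw [hU.map_seed_map, hconv, Measure.conv_comm]
  exact Measure.conv_absolutelyContinuous (hac x)

theorem minorizedOnBalls_map_seed :
    MinorizedOnBalls volume fun x => (Pr.map (ξ 0)).map (U x) := by
  obtain ⟨νa, νb, hνa, hνb, hconv, -, hmin⟩ := hd.exists_conv_eq_map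
  have hlaw (x) : (Pr.map (ξ 0)).map (U x) = νa x ∗ νb x := (hU.map_seed_map x).trans (hconv x)
  simp only [hlaw]
  refine hmin.conv hνa hνb (ENNReal.ofReal_ne_top (r := σ ^ 2)) fun x => ?_
  rw [← hlaw, lintegral_map (by fun_prop) hU.measurable_field.of_uncurry_left]
  exact hU.lintegral_seed x

end HasSquareIntegrableNoise

end Noise

section Contraction

variable {E : Type*} [NormedAddCommGroup E]

theorem mul_mul_sq_norm_add_le {A B : ℝ} (hA : 0 ≤ A) (hB : 0 ≤ B) (u v : E) :
    A * B * ‖u + v‖ ^ 2 ≤ (A + B) * (A * ‖u‖ ^ 2 + B * ‖v‖ ^ 2) := by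
  calc A * B * ‖u + v‖ ^ 2 ≤ A * B * (‖u‖ + ‖v‖) ^ 2 := by gcongr; exact norm_add_le u v
    _ = (A + B) * (A * ‖u‖ ^ 2 + B * ‖v‖ ^ 2) - (A * ‖u‖ - B * ‖v‖) ^ 2 := by ring
    _ ≤ (A + B) * (A * ‖u‖ ^ 2 + B * ‖v‖ ^ 2) := sub_le_self _ (sq_nonneg _)

theorem enorm_add_sq_le (u v : E) : ‖u + v‖ₑ ^ 2 ≤ 2 * (‖u‖ₑ ^ 2 + ‖v‖ₑ ^ 2) := by
  have h : ‖u + v‖₊ ^ 2 ≤ 2 * (‖u‖₊ ^ 2 + ‖v‖₊ ^ 2) :=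
    (pow_le_pow_left₀ zero_le (nnnorm_add_le u v) 2).trans add_sq_le
  simpa [enorm_eq_nnnorm] using ENNReal.coe_le_coe.2 h

/-- Up to an additive error, the map `T` shrinks squared distances to `xs` by a constant factor
smaller than `1`. -/
def ContractsTowards (T : E → E) (xs : E) : Prop :=
  ∃ q C : ℝ, q < 1 ∧ ∀ x, ‖T x - xs‖ ^ 2 ≤ q * ‖x - xs‖ ^ 2 + C

theorem ContractsTowards.exists_sq_norm_sub_le {T : E → E} {xs : E} (hT : ContractsTowards T xs) :
    ∃ β b c : ℝ≥0, β < 1 ∧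
      ∀ x y, ‖y - xs‖₊ ^ 2 ≤ β * ‖x - xs‖₊ ^ 2 + b + c * ‖y - T x‖₊ ^ 2 := by
  obtain ⟨q, C, hq, hqT⟩ := hT
  set q' := max q 0
  set η := (1 - q') / 2
  have hq'0 : 0 ≤ q' := le_max_right _ _
  have hq'1 : q' < 1 := max_lt hq one_pos
  have hη : 0 < η := half_pos (sub_pos.2 hq'1)
  refine ⟨⟨(1 + η) * q', by positivity⟩, ⟨(1 + η) * max C 0, by positivity⟩,
    ⟨(1 + η) / η, by positivity⟩, ?_, fun x y => ?_⟩
  · change (1 + η) * q' < 1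
    nlinarith [show q' = 1 - 2 * η by ring]
  change ‖y - xs‖ ^ 2 ≤
    (1 + η) * q' * ‖x - xs‖ ^ 2 + (1 + η) * max C 0 + (1 + η) / η * ‖y - T x‖ ^ 2
  have hyoung : η * ‖y - xs‖ ^ 2 ≤ (1 + η) * (η * ‖T x - xs‖ ^ 2 + ‖y - T x‖ ^ 2) := by
    simpa [add_comm] using mul_mul_sq_norm_add_le hη.le zero_le_one (T x - xs) (y - T x)
  have hTx : ‖T x - xs‖ ^ 2 ≤ q' * ‖x - xs‖ ^ 2 + max C 0 := by
    refine (hqT x).trans ?_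
    gcongr
    exacts [le_max_left _ _, le_max_left _ _]
  calc ‖y - xs‖ ^ 2 ≤ (1 + η) * (η * ‖T x - xs‖ ^ 2 + ‖y - T x‖ ^ 2) / η :=
        (le_div_iff₀' hη).2 hyoung
    _ = (1 + η) * ‖T x - xs‖ ^ 2 + (1 + η) / η * ‖y - T x‖ ^ 2 := by field_simp
    _ ≤ (1 + η) * (q' * ‖x - xs‖ ^ 2 + max C 0) + (1 + η) / η * ‖y - T x‖ ^ 2 := by gcongr
    _ = _ := by ring

theorem ContractsTowards.hasGeometricDrift [MeasurableSpace E] [BorelSpace E] {T : E → E} {xs : E}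
    (hT : ContractsTowards T xs) {P : Kernel E E} [IsMarkovKernel P] {G : ℝ≥0∞} (hG : G ≠ ⊤)
    (hP : ∀ x, ∫⁻ y, ‖y - T x‖ₑ ^ 2 ∂(P x) ≤ G) :
    HasGeometricDrift P fun x => ‖x - xs‖₊ ^ 2 := by
  lift G to ℝ≥0 using hG
  obtain ⟨β, b, c, hβ, hle⟩ := hT.exists_sq_norm_sub_le
  refine ⟨β, b + c * G, hβ, fun x => ?_⟩
  calc ∫⁻ y, ((‖y - xs‖₊ ^ 2 : ℝ≥0) : ℝ≥0∞) ∂(P x)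
      ≤ ∫⁻ y, ((β * ‖x - xs‖₊ ^ 2 + b : ℝ≥0) : ℝ≥0∞) + c * ‖y - T x‖ₑ ^ 2 ∂(P x) :=
        lintegral_mono fun y => by
          simpa only [enorm_eq_nnnorm, ENNReal.coe_add, ENNReal.coe_mul, ENNReal.coe_pow] using
            ENNReal.coe_le_coe.2 (hle x y)
    _ = ((β * ‖x - xs‖₊ ^ 2 + b : ℝ≥0) : ℝ≥0∞) + c * ∫⁻ y, ‖y - T x‖ₑ ^ 2 ∂(P x) := by
        rw [lintegral_add_left measurable_const, lintegral_const_mul' _ _ ENNReal.coe_ne_top,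
          lintegral_const, measure_univ, mul_one]
    _ ≤ ((β * ‖x - xs‖₊ ^ 2 + b : ℝ≥0) : ℝ≥0∞) + c * G := by gcongr; exact hP x
    _ = β * ((‖x - xs‖₊ ^ 2 : ℝ≥0) : ℝ≥0∞) + ((b + c * G : ℝ≥0) : ℝ≥0∞) := by
        push_cast
        ring

variable [InnerProductSpace ℝ E] {F : E → E} {xs : E} {lam mu : ℝ}

theorem norm_sub_smul_sub_sq (x g z : E) (τ : ℝ) :
    ‖x - τ • g - z‖ ^ 2 = ‖x - z‖ ^ 2 - 2 * τ * inner ℝ g (x - z) + τ ^ 2 * ‖g‖ ^ 2 := by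
  rw [sub_right_comm, norm_sub_sq_real, norm_smul, mul_pow, Real.norm_eq_abs, sq_abs,
    inner_smul_right, real_inner_comm]
  ring

theorem contractsTowards_gradientStep
    (hmono : ∀ x, mu * ‖x - xs‖ ^ 2 - lam ≤ inner ℝ (F x) (x - xs)) {l γ : ℝ}
    (hl : ∀ x, ‖F x‖ ≤ l * (1 + ‖x‖)) (hγ : 0 < γ) (hγl : γ * l ^ 2 < 2 * mu) :
    ContractsTowards (fun x => x - γ • F x) xs := by
  set t := γ * (2 * mu - γ * l ^ 2) with ht
  have ht0 : 0 < t := mul_pos hγ (by linarith)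
  set m := 1 + ‖xs‖
  refine ⟨1 - t / 2, 2 * γ * lam + γ ^ 2 * l ^ 2 * m ^ 2 * (1 + 2 * (γ ^ 2 * l ^ 2) / t),
    by linarith, fun x => ?_⟩
  set r := ‖x - xs‖
  have hxr : 1 + ‖x‖ ≤ r + m := by linarith [norm_le_norm_sub_add x xs]
  have hF : ‖F x‖ ^ 2 ≤ l ^ 2 * (r + m) ^ 2 := by
    calc ‖F x‖ ^ 2 ≤ (l * (1 + ‖x‖)) ^ 2 := by gcongr; exact hl x
      _ = l ^ 2 * (1 + ‖x‖) ^ 2 := mul_pow _ _ _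
      _ ≤ l ^ 2 * (r + m) ^ 2 := by gcongr
  have hyoung : 2 * (γ ^ 2 * l ^ 2) * m * r ≤
      t / 2 * r ^ 2 + γ ^ 2 * l ^ 2 * m ^ 2 * (2 * (γ ^ 2 * l ^ 2) / t) := by
    have hsq : 0 ≤ t / 2 * (r - 2 * (γ ^ 2 * l ^ 2) * m / t) ^ 2 := by positivity
    refine (sub_nonneg.1 (hsq.trans_eq ?_))
    field_simp
    ring
  calc ‖x - γ • F x - xs‖ ^ 2
      = r ^ 2 - 2 * γ * inner ℝ (F x) (x - xs) + γ ^ 2 * ‖F x‖ ^ 2 :=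
        norm_sub_smul_sub_sq x (F x) xs γ
    _ ≤ r ^ 2 - 2 * γ * (mu * r ^ 2 - lam) + γ ^ 2 * (l ^ 2 * (r + m) ^ 2) := by
        gcongr
        exact hmono x
    _ = (1 - t) * r ^ 2 + 2 * γ * lam + γ ^ 2 * l ^ 2 * m ^ 2 + 2 * (γ ^ 2 * l ^ 2) * m * r := by
        rw [ht]
        ring
    _ ≤ _ := by linarith

theorem le_two_mul_inner_extragradient
    (hmono : ∀ x, mu * ‖x - xs‖ ^ 2 - lam ≤ inner ℝ (F x) (x - xs)) {L : ℝ≥0}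
    (hL : LipschitzWith L F) {γ : ℝ} (hγ : 0 < γ) (x : E) :
    2 * mu * ‖x - γ • F x - xs‖ ^ 2 - 2 * lam + γ * (1 - (L * γ) ^ 2) * ‖F x‖ ^ 2 ≤
      2 * inner ℝ (F (x - γ • F x)) (x - xs) - γ * ‖F (x - γ • F x)‖ ^ 2 := by
  set y := x - γ • F x with hy
  have hlip : ‖F y - F x‖ ≤ L * (γ * ‖F x‖) := by
    calc ‖F y - F x‖ ≤ L * ‖y - x‖ := hL.norm_sub_le y x
      _ = L * (γ * ‖F x‖) := by
        rw [hy, sub_sub_cancel_left, norm_neg, norm_smul, Real.norm_of_nonneg hγ.le]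
  have hsplit : inner ℝ (F y) (x - xs) = inner ℝ (F y) (y - xs) + γ * inner ℝ (F y) (F x) := by
    rw [← inner_smul_right, ← inner_add_right]
    congr 1
    rw [hy]
    abel
  have hpolar : ‖F y - F x‖ ^ 2 = ‖F y‖ ^ 2 - 2 * inner ℝ (F y) (F x) + ‖F x‖ ^ 2 :=
    norm_sub_sq_real _ _
  have hlip_sq : γ * ‖F y - F x‖ ^ 2 ≤ γ * (L * (γ * ‖F x‖)) ^ 2 := by gcongr
  rw [hpolar] at hlip_sq
  rw [hsplit]
  linarith [hmono y]

theorem contractsTowards_extragradientStep (hmu : 0 < mu)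
    (hmono : ∀ x, mu * ‖x - xs‖ ^ 2 - lam ≤ inner ℝ (F x) (x - xs)) {L : ℝ≥0}
    (hL : LipschitzWith L F) {γ α : ℝ} (hγ : 0 < γ) (hLγ : L * γ < 1) (hα : 0 < α) (hα1 : α ≤ 1) :
    ContractsTowards (fun x => x - (α * γ) • F (x - γ • F x)) xs := by
  set B := (1 - (L * γ) ^ 2) / γ with hB
  have hB0 : 0 < B := div_pos (sub_pos.2 (pow_lt_one₀ (by positivity) hLγ two_ne_zero)) hγ
  set κ := 2 * mu * B / (2 * mu + B)
  have hκ : 0 < κ := by positivity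
  refine ⟨1 - α * γ * κ, 2 * (α * γ) * lam, sub_lt_self _ (mul_pos (mul_pos hα hγ) hκ), fun x => ?_⟩
  set y := x - γ • F x with hy
  have hsplit : κ * ‖x - xs‖ ^ 2 ≤ 2 * mu * ‖y - xs‖ ^ 2 + γ * (1 - (L * γ) ^ 2) * ‖F x‖ ^ 2 := by
    have hsum : x - xs = (y - xs) + γ • F x := by rw [hy]; abel
    have hnorm : γ * (1 - (L * γ) ^ 2) * ‖F x‖ ^ 2 = B * ‖γ • F x‖ ^ 2 := by
      rw [norm_smul, Real.norm_of_nonneg hγ.le, hB]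
      field_simp
    rw [hnorm, hsum, div_mul_eq_mul_div, div_le_iff₀' (by positivity)]
    exact mul_mul_sq_norm_add_le (by positivity) hB0.le _ _
  calc ‖x - (α * γ) • F y - xs‖ ^ 2
      = ‖x - xs‖ ^ 2 - α * γ * (2 * inner ℝ (F y) (x - xs) - α * (γ * ‖F y‖ ^ 2)) := by
        rw [norm_sub_smul_sub_sq]
        ring
    _ ≤ ‖x - xs‖ ^ 2 - α * γ * (2 * inner ℝ (F y) (x - xs) - 1 * (γ * ‖F y‖ ^ 2)) := by gcongr
    _ ≤ ‖x - xs‖ ^ 2 - α * γ * (κ * ‖x - xs‖ ^ 2 - 2 * lam) := by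
        refine sub_le_sub_left (mul_le_mul_of_nonneg_left ?_ (by positivity)) _
        linarith [le_two_mul_inner_extragradient hmono hL hγ x]
    _ = (1 - α * γ * κ) * ‖x - xs‖ ^ 2 + 2 * (α * γ) * lam := by ring

end Contraction

section Oracle

variable {E S : Type*} [NormedAddCommGroup E] [NormedSpace ℝ E]

/-- One noisy step from `p.1` along the oracle evaluated at `p.2`, with seed `s`. The two points
differ in the update of the extragradient method. -/
def oracleStep (F : E → E) (U : E → S → E) (τ : ℝ) (p : E × E) (s : S) : E :=
  p.1 - τ • (F p.2 + U p.2 s)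

/-- One step of stochastic gradient descent ascent. -/
def sgdaStep (F : E → E) (U : E → S → E) (γ : ℝ) (x : E) (s : S) : E :=
  oracleStep F U γ (x, x) s

/-- One step of stochastic extragradient; the two seeds are those of the look-ahead and of the
update. -/
def segStep (F : E → E) (U : E → S → E) (γ α : ℝ) (x : E) (s : S × S) : E :=
  oracleStep F U (α * γ) (x, sgdaStep F U γ x s.1) s.2

theorem oracleStep_eq (F : E → E) (U : E → S → E) (τ : ℝ) (p : E × E) :
    oracleStep F U τ p = (fun u => p.1 - τ • F p.2 - τ • u) ∘ U p.2 := by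
  ext1 s
  rw [oracleStep, smul_add, ← sub_sub]
  rfl

theorem enorm_sgdaStep_sub {F : E → E} {U : E → S → E} (γ : ℝ) (x : E) (s : S) :
    ‖sgdaStep F U γ x s - (x - γ • F x)‖ₑ = ‖γ‖ₑ * ‖U x s‖ₑ := by
  rw [sgdaStep, oracleStep, smul_add, ← sub_sub, sub_sub_cancel_left, enorm_neg, enorm_smul]

theorem enorm_segStep_sub_sq_le {F : E → E} {L : ℝ≥0} (hL : LipschitzWith L F)
    (U : E → S → E) (γ α : ℝ) (x : E) (s : S × S) :
    ‖segStep F U γ α x s - (x - (α * γ) • F (x - γ • F x))‖ₑ ^ 2 ≤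
      2 * ‖α * γ‖ₑ ^ 2 * (L * ‖γ‖ₑ) ^ 2 * ‖U x s.1‖ₑ ^ 2 +
        2 * ‖α * γ‖ₑ ^ 2 * ‖U (sgdaStep F U γ x s.1) s.2‖ₑ ^ 2 := by
  set y := x - γ • F x
  set y' := sgdaStep F U γ x s.1
  have hlip : ‖F y' - F y‖ₑ ≤ L * ‖γ‖ₑ * ‖U x s.1‖ₑ := by
    rw [mul_assoc, ← enorm_sgdaStep_sub (F := F) γ x s.1, ← edist_eq_enorm_sub,
      ← edist_eq_enorm_sub]
    exact hL y' y
  have hdev : segStep F U γ α x s - (x - (α * γ) • F y) =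
      -((α * γ) • ((F y' - F y) + U y' s.2)) := by
    simp only [segStep, oracleStep, y']
    module
  calc ‖segStep F U γ α x s - (x - (α * γ) • F y)‖ₑ ^ 2
      = ‖α * γ‖ₑ ^ 2 * ‖(F y' - F y) + U y' s.2‖ₑ ^ 2 := by
        rw [hdev, enorm_neg, enorm_smul, mul_pow]
    _ ≤ ‖α * γ‖ₑ ^ 2 * (2 * ((L * ‖γ‖ₑ * ‖U x s.1‖ₑ) ^ 2 + ‖U y' s.2‖ₑ ^ 2)) := by
        gcongr _ * ?_
        exact (enorm_add_sq_le _ _).trans (by gcongr)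
    _ = _ := by ring

variable [MeasurableSpace E] [BorelSpace E] [SecondCountableTopology E] [MeasurableSpace S]
  {F : E → E} {U : E → S → E}

theorem measurable_oracleStep (hF : Measurable F) (hU : Measurable (Function.uncurry U)) (τ : ℝ) :
    Measurable (Function.uncurry (oracleStep F U τ)) := by
  have hUp : Measurable fun q : (E × E) × S => U q.1.2 q.2 :=
    hU.comp ((measurable_snd.comp measurable_fst).prodMk measurable_snd)
  exact (measurable_fst.comp measurable_fst).sub
    (((hF.comp (measurable_snd.comp measurable_fst)).add hUp).const_smul τ)

theorem measurable_sgdaStep (hF : Measurable F) (hU : Measurable (Function.uncurry U)) (γ : ℝ) :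
    Measurable (Function.uncurry (sgdaStep F U γ)) :=
  (measurable_oracleStep hF hU γ).comp
    ((measurable_fst.prodMk measurable_fst).prodMk measurable_snd)

theorem measurable_segStep (hF : Measurable F) (hU : Measurable (Function.uncurry U)) (γ α : ℝ) :
    Measurable (Function.uncurry (segStep F U γ α)) := by
  have hlook : Measurable fun q : E × S × S => sgdaStep F U γ q.1 q.2.1 :=
    (measurable_sgdaStep hF hU γ).comp
      (measurable_fst.prodMk (measurable_fst.comp measurable_snd))
  exact (measurable_oracleStep hF hU (α * γ)).comp
    ((measurable_fst.prodMk hlook).prodMk (measurable_snd.comp measurable_snd))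

variable {ρ : Measure S} [SFinite ρ]

theorem randomMapKernel_sgdaStep_apply (hF : Measurable F) (hU : Measurable (Function.uncurry U))
    (γ : ℝ) (x : E) :
    randomMapKernel ρ (sgdaStep F U γ) x = randomMapKernel ρ (oracleStep F U γ) (x, x) := by
  rw [randomMapKernel_apply ρ (measurable_sgdaStep hF hU γ),
    randomMapKernel_apply ρ (measurable_oracleStep hF hU γ)]
  rfl

theorem randomMapKernel_segStep_apply (hF : Measurable F) (hU : Measurable (Function.uncurry U))
    (γ α : ℝ) (x : E) :
    randomMapKernel (ρ.prod ρ) (segStep F U γ α) x =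
      (randomMapKernel ρ (oracleStep F U γ) (x, x)).bind fun y =>
        randomMapKernel ρ (oracleStep F U (α * γ)) (x, y) := by
  have hlook : Measurable (sgdaStep F U γ x) := (measurable_sgdaStep hF hU γ).of_uncurry_left
  have hupdate : Measurable (Function.uncurry fun y => oracleStep F U (α * γ) (x, y)) :=
    (measurable_oracleStep hF hU (α * γ)).comp
      ((measurable_prodMk_left.comp measurable_fst).prodMk measurable_snd)
  have hκ : (fun y => randomMapKernel ρ (oracleStep F U (α * γ)) (x, y)) =
      randomMapKernel ρ fun y => oracleStep F U (α * γ) (x, y) := by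
    ext1 y
    rw [randomMapKernel_apply ρ hupdate,
      randomMapKernel_apply ρ (measurable_oracleStep hF hU (α * γ))]
  have hprod : (ρ.map (sgdaStep F U γ x)).prod ρ =
      (ρ.prod ρ).map (Prod.map (sgdaStep F U γ x) id) := by
    rw [← Measure.map_prod_map _ _ hlook measurable_id, Measure.map_id]
  rw [hκ, ← randomMapKernel_sgdaStep_apply hF hU,
    randomMapKernel_apply ρ (measurable_sgdaStep hF hU γ), bind_randomMapKernel _ _ hupdate,
    randomMapKernel_apply _ (measurable_segStep hF hU γ α), hprod,
    Measure.map_map hupdate (hlook.prodMap measurable_id)]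
  rfl

end Oracle

section OracleKernels

variable {d : ℕ} {Ω S : Type*} [MeasurableSpace Ω] [MeasurableSpace S] {Pr : Measure Ω}
  [IsProbabilityMeasure Pr] {ξ : ℕ → Ω → S}
  {F : EuclideanSpace ℝ (Fin d) → EuclideanSpace ℝ (Fin d)}
  {U : EuclideanSpace ℝ (Fin d) → S → EuclideanSpace ℝ (Fin d)} {σ : ℝ}

theorem linearGrowth_of_lipschitzWith {L : ℝ≥0} (hL : LipschitzWith L F) :
    LinearGrowth F (max L ‖F 0‖) := by
  intro x
  have hlip : ‖F x - F 0‖ ≤ L * ‖x‖ := by simpa using hL.norm_sub_le x 0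
  have hL' := mul_le_mul_of_nonneg_right (le_max_left (L : ℝ) ‖F 0‖) (norm_nonneg x)
  linarith [norm_le_norm_sub_add (F x) (F 0), le_max_right (L : ℝ) ‖F 0‖]

theorem LinearGrowth.nonneg {l : ℝ} (hl : LinearGrowth F l) : 0 ≤ l := by
  simpa using (norm_nonneg (F 0)).trans (hl 0)

theorem randomMapKernel_oracleStep_apply (hF : Measurable F)
    (hU : HasSquareIntegrableNoise Pr ξ U σ) (τ : ℝ)
    (p : EuclideanSpace ℝ (Fin d) × EuclideanSpace ℝ (Fin d)) :
    randomMapKernel (Pr.map (ξ 0)) (oracleStep F U τ) p =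
      ((Pr.map (ξ 0)).map (U p.2)).map fun u => p.1 - τ • F p.2 - τ • u := by
  rw [randomMapKernel_apply _ (measurable_oracleStep hF hU.measurable_field τ), oracleStep_eq,
    Measure.map_map (by fun_prop) hU.measurable_field.of_uncurry_left]

theorem randomMapKernel_oracleStep_absolutelyContinuous (hF : Measurable F)
    (hU : HasSquareIntegrableNoise Pr ξ U σ) (hd : HasPositiveDensityPart Pr ξ U) {τ : ℝ}
    (hτ : τ ≠ 0) (p : EuclideanSpace ℝ (Fin d) × EuclideanSpace ℝ (Fin d)) :
    randomMapKernel (Pr.map (ξ 0)) (oracleStep F U τ) p ≪ volume := by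
  rw [randomMapKernel_oracleStep_apply hF hU]
  exact map_sub_smul_absolutelyContinuous hτ _ (hU.map_seed_map_absolutelyContinuous hd _)

theorem minorizedOnBalls_oracleStep (hF : Measurable F) {l : ℝ} (hl : LinearGrowth F l)
    (hU : HasSquareIntegrableNoise Pr ξ U σ) (hd : HasPositiveDensityPart Pr ξ U) {τ : ℝ}
    (hτ : τ ≠ 0) :
    MinorizedOnBalls volume (randomMapKernel (Pr.map (ξ 0)) (oracleStep F U τ)) := by
  have hbounded (R : ℝ) : ∃ M, ∀ p : EuclideanSpace ℝ (Fin d) × EuclideanSpace ℝ (Fin d),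
      ‖p‖ ≤ R → ‖p.1 - τ • F p.2‖ ≤ M := by
    refine ⟨R + |τ| * (l * (1 + R)), fun p hp => (norm_sub_le _ _).trans ?_⟩
    have hl0 := hl.nonneg
    have hF_le : ‖F p.2‖ ≤ l * (1 + R) := (hl p.2).trans <| by
      gcongr
      exact (norm_snd_le p).trans hp
    rw [norm_smul, Real.norm_eq_abs]
    gcongr
    exact (norm_fst_le p).trans hp
  rw [funext (randomMapKernel_oracleStep_apply hF hU τ)]
  exact ((hU.minorizedOnBalls_map_seed hd).comp norm_snd_le).map_sub_smul hτ hbounded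

theorem lintegral_sgdaStep_sub_sq_le (hF : Measurable F) (hU : HasSquareIntegrableNoise Pr ξ U σ)
    (γ : ℝ) (x : EuclideanSpace ℝ (Fin d)) :
    ∫⁻ y, ‖y - (x - γ • F x)‖ₑ ^ 2 ∂(randomMapKernel (Pr.map (ξ 0)) (sgdaStep F U γ) x) ≤
      ‖γ‖ₑ ^ 2 * ENNReal.ofReal (σ ^ 2) := by
  have hstep := measurable_sgdaStep hF hU.measurable_field γ
  rw [randomMapKernel_apply _ hstep, lintegral_map (by fun_prop) hstep.of_uncurry_left]
  simp only [enorm_sgdaStep_sub, mul_pow]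
  rw [lintegral_const_mul' _ _ (by finiteness)]
  gcongr
  exact hU.lintegral_seed x

theorem lintegral_segStep_sub_sq_le {L : ℝ≥0} (hL : LipschitzWith L F)
    (hU : HasSquareIntegrableNoise Pr ξ U σ) (γ α : ℝ) (x : EuclideanSpace ℝ (Fin d)) :
    ∫⁻ y, ‖y - (x - (α * γ) • F (x - γ • F x))‖ₑ ^ 2
        ∂(randomMapKernel ((Pr.map (ξ 0)).prod (Pr.map (ξ 0))) (segStep F U γ α) x) ≤
      2 * ‖α * γ‖ₑ ^ 2 * (L * ‖γ‖ₑ) ^ 2 * ENNReal.ofReal (σ ^ 2) +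
        2 * ‖α * γ‖ₑ ^ 2 * ENNReal.ofReal (σ ^ 2) := by
  have := Measure.isProbabilityMeasure_map (μ := Pr) (hU.measurable_seed 0).aemeasurable
  have hF := hL.continuous.measurable
  have hstep := measurable_segStep hF hU.measurable_field γ α
  have hlook : Measurable (sgdaStep F U γ x) :=
    (measurable_sgdaStep hF hU.measurable_field γ).of_uncurry_left
  have hUx : Measurable (U x) := hU.measurable_field.of_uncurry_left
  have hUlook : Measurable fun s : S × S => U (sgdaStep F U γ x s.1) s.2 :=
    hU.measurable_field.comp ((hlook.comp measurable_fst).prodMk measurable_snd)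
  have hfirst : ∫⁻ s, ‖U x s.1‖ₑ ^ 2 ∂((Pr.map (ξ 0)).prod (Pr.map (ξ 0))) ≤
      ENNReal.ofReal (σ ^ 2) := by
    rw [lintegral_prod _ (by fun_prop)]
    simp only [lintegral_const, measure_univ, mul_one]
    exact hU.lintegral_seed x
  have hsecond : ∫⁻ s, ‖U (sgdaStep F U γ x s.1) s.2‖ₑ ^ 2
      ∂((Pr.map (ξ 0)).prod (Pr.map (ξ 0))) ≤ ENNReal.ofReal (σ ^ 2) := by
    rw [lintegral_prod _ (hUlook.enorm.pow_const 2).aemeasurable]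
    exact (lintegral_mono fun s => hU.lintegral_seed _).trans_eq (by simp)
  rw [randomMapKernel_apply _ hstep, lintegral_map (by fun_prop) hstep.of_uncurry_left]
  refine (lintegral_mono fun s => enorm_segStep_sub_sq_le hL U γ α x s).trans ?_
  rw [lintegral_add_left (by fun_prop), lintegral_const_mul' _ _ (by finiteness),
    lintegral_const_mul' _ _ (by finiteness)]
  gcongr

variable {X₀ : Ω → EuclideanSpace ℝ (Fin d)}

theorem isMarkovChain_sgda (hF : Measurable F) (hU : HasSquareIntegrableNoise Pr ξ U σ) (γ : ℝ)
    (hX₀ : Measurable X₀) (hind : IndepFun X₀ (fun ω k => ξ k ω) Pr) :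
    IsMarkovChain Pr (randomMapKernel (Pr.map (ξ 0)) (sgdaStep F U γ)) (Pr.map X₀)
      (sgda F U ξ γ X₀) := by
  have := Measure.isProbabilityMeasure_map (μ := Pr) (hU.measurable_seed 0).aemeasurable
  refine isMarkovChain_of_recursion (Φ := sgda F U ξ γ X₀) (ζ := ξ)
    (measurable_sgdaStep hF hU.measurable_field γ) hX₀ hU.measurable_seed
    (fun n => (hU.ident n).map_eq) (fun n => ?_) fun n ω => rfl
  exact (indepFun_prodMk_finset hX₀ hU.measurable_seed hind hU.indep
    (Finset.disjoint_singleton_right.2 Finset.notMem_range_self)).comp measurable_id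
      (measurable_pi_apply (⟨n, Finset.mem_singleton_self n⟩ : ({n} : Finset ℕ)))

theorem isMarkovChain_seg (hF : Measurable F) (hU : HasSquareIntegrableNoise Pr ξ U σ) (γ α : ℝ)
    (hX₀ : Measurable X₀) (hind : IndepFun X₀ (fun ω k => ξ k ω) Pr) :
    IsMarkovChain Pr (randomMapKernel ((Pr.map (ξ 0)).prod (Pr.map (ξ 0))) (segStep F U γ α))
      (Pr.map X₀) (seg F U ξ γ α X₀) := by
  have := Measure.isProbabilityMeasure_map (μ := Pr) (hU.measurable_seed 0).aemeasurable
  have hξ := hU.measurable_seed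
  refine isMarkovChain_of_recursion (Φ := seg F U ξ γ α X₀)
    (ζ := fun n ω => (ξ (2 * n) ω, ξ (2 * n + 1) ω))
    (measurable_segStep hF hU.measurable_field γ α) hX₀ (fun n => (hξ _).prodMk (hξ _))
    (fun n => ?_) (fun n => ?_) fun n ω => rfl
  · rw [(hU.indep.indepFun (by omega)).map_prod_eq_prod_map_map (hξ _).aemeasurable
      (hξ _).aemeasurable, (hU.ident _).map_eq, (hU.ident (2 * n + 1)).map_eq]
  · have hdisj : Disjoint (Finset.range (2 * n)) {2 * n, 2 * n + 1} := by simp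
    have hmem (k : Finset.range n) :
        2 * (k : ℕ) ∈ Finset.range (2 * n) ∧ 2 * (k : ℕ) + 1 ∈ Finset.range (2 * n) := by
      have := Finset.mem_range.1 k.2
      simp only [Finset.mem_range]
      omega
    exact (indepFun_prodMk_finset hX₀ hξ hind hU.indep hdisj).comp
      (φ := fun q => (q.1, fun k : Finset.range n =>
        (q.2 ⟨2 * k, (hmem k).1⟩, q.2 ⟨2 * k + 1, (hmem k).2⟩)))
      (ψ := fun w : ({2 * n, 2 * n + 1} : Finset ℕ) → S =>
        (w ⟨2 * n, by simp⟩, w ⟨2 * n + 1, by simp⟩))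
      (by fun_prop) (by fun_prop)

end OracleKernels

section Convergence

/-- The algorithm `run`, which turns an initial point into a sequence of iterates by means of the
random seeds `ξ`, is a positive Harris chain: for all initial points that are independent of the
seeds, its iterates form a Markov chain with the same positive Harris kernel. -/
def RunsPositiveHarrisChain {E Ω S : Type*} [MeasurableSpace E] [MeasurableSpace Ω]
    [MeasurableSpace S] (Pr : Measure Ω) (ξ : ℕ → Ω → S) (run : (Ω → E) → ℕ → Ω → E) : Prop :=
  ∃ (P : Kernel E E) (_ : IsMarkovKernel P) (ψ : Measure E),
    (∀ X₀ : Ω → E, Measurable X₀ → IndepFun X₀ (fun ω k => ξ k ω) Pr →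
      IsMarkovChain Pr P (Pr.map X₀) (run X₀)) ∧
    IsPositiveHarris P ψ

variable {d : ℕ} {Ω S : Type*} [MeasurableSpace Ω] [MeasurableSpace S] {Pr : Measure Ω}
  [IsProbabilityMeasure Pr] {ξ : ℕ → Ω → S}
  {F : EuclideanSpace ℝ (Fin d) → EuclideanSpace ℝ (Fin d)}
  {U : EuclideanSpace ℝ (Fin d) → S → EuclideanSpace ℝ (Fin d)} {σ lam mu : ℝ}
  {xs : EuclideanSpace ℝ (Fin d)}

theorem runsPositiveHarrisChain_sgda (hF : Measurable F)
    (hmono : ∀ x, mu * ‖x - xs‖ ^ 2 - lam ≤ inner ℝ (F x) (x - xs))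
    (hU : HasSquareIntegrableNoise Pr ξ U σ) (hd : HasPositiveDensityPart Pr ξ U) {l γ : ℝ}
    (hl : LinearGrowth F l) (hγ : 0 < γ) (hγl : γ * l ^ 2 < 2 * mu) :
    RunsPositiveHarrisChain Pr ξ (sgda F U ξ γ) := by
  have := Measure.isProbabilityMeasure_map (μ := Pr) (hU.measurable_seed 0).aemeasurable
  have := isMarkovKernel_randomMapKernel (Pr.map (ξ 0))
    (measurable_sgdaStep hF hU.measurable_field γ)
  have hlaw := randomMapKernel_sgdaStep_apply (ρ := Pr.map (ξ 0)) hF hU.measurable_field γ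
  refine ⟨randomMapKernel (Pr.map (ξ 0)) (sgdaStep F U γ), this, volume,
    fun X₀ => isMarkovChain_sgda hF hU γ, ?_⟩
  have hmin : MinorizedOnBalls volume (randomMapKernel (Pr.map (ξ 0)) (sgdaStep F U γ)) := by
    rw [funext hlaw]
    exact (minorizedOnBalls_oracleStep hF hl hU hd hγ.ne').comp fun x => (max_self ‖x‖).le
  have hdrift := (contractsTowards_gradientStep hmono hl hγ hγl).hasGeometricDrift
    (by finiteness) (lintegral_sgdaStep_sub_sq_le hF hU γ)
  refine (hmin.hasSmallSublevels xs).isPositiveHarris hdrift (by fun_prop) (NeZero.ne _)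
    fun x => ?_
  rw [hlaw]
  exact randomMapKernel_oracleStep_absolutelyContinuous hF hU hd hγ.ne' _

theorem runsPositiveHarrisChain_seg (hmu : 0 < mu)
    (hmono : ∀ x, mu * ‖x - xs‖ ^ 2 - lam ≤ inner ℝ (F x) (x - xs))
    (hU : HasSquareIntegrableNoise Pr ξ U σ) (hd : HasPositiveDensityPart Pr ξ U) {L : ℝ≥0}
    {γ α : ℝ} (hL : LipschitzWith L F) (hγ : 0 < γ) (hLγ : L * γ < 1) (hα : 0 < α)
    (hα1 : α ≤ 1) :
    RunsPositiveHarrisChain Pr ξ (seg F U ξ γ α) := by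
  have := Measure.isProbabilityMeasure_map (μ := Pr) (hU.measurable_seed 0).aemeasurable
  have hF := hL.continuous.measurable
  have := isMarkovKernel_randomMapKernel ((Pr.map (ξ 0)).prod (Pr.map (ξ 0)))
    (measurable_segStep hF hU.measurable_field γ α)
  have hαγ : α * γ ≠ 0 := (mul_pos hα hγ).ne'
  have hlaw := randomMapKernel_segStep_apply (ρ := Pr.map (ξ 0)) hF hU.measurable_field γ α
  have hupdate (x : EuclideanSpace ℝ (Fin d)) :
      Measurable fun y => randomMapKernel (Pr.map (ξ 0)) (oracleStep F U (α * γ)) (x, y) :=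
    (Kernel.measurable _).comp measurable_prodMk_left
  refine ⟨randomMapKernel ((Pr.map (ξ 0)).prod (Pr.map (ξ 0))) (segStep F U γ α), this, volume,
    fun X₀ => isMarkovChain_seg hF hU γ α, ?_⟩
  have hgrowth := linearGrowth_of_lipschitzWith hL
  have hmin : MinorizedOnBalls volume
      (randomMapKernel ((Pr.map (ξ 0)).prod (Pr.map (ξ 0))) (segStep F U γ α)) := by
    rw [funext hlaw]
    exact ((minorizedOnBalls_oracleStep hF hgrowth hU hd hγ.ne').comp
      fun x => (max_self ‖x‖).le).bind (minorizedOnBalls_oracleStep hF hgrowth hU hd hαγ) hupdate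
  have hdrift := (contractsTowards_extragradientStep hmu hmono hL hγ hLγ hα hα1).hasGeometricDrift
    (by finiteness) (lintegral_segStep_sub_sq_le hL hU γ α)
  refine (hmin.hasSmallSublevels xs).isPositiveHarris hdrift (by fun_prop) (NeZero.ne _)
    fun x => ?_
  rw [hlaw]
  refine Measure.AbsolutelyContinuous.mk fun s hs hs0 => ?_
  rw [Measure.bind_apply hs (hupdate x).aemeasurable]
  simp only [randomMapKernel_oracleStep_absolutelyContinuous hF hU hd hαγ _ hs0, lintegral_zero]

end Convergence

theorem mul_sq_lt_two_mul_of_lt_div_sq {γ l mu : ℝ} (hmu : 0 < mu) (hγ : 0 < γ)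
    (hγl : γ < mu / l ^ 2) : γ * l ^ 2 < 2 * mu := by
  have hl : 0 < l ^ 2 := (sq_nonneg l).lt_of_ne' fun hl => by
    rw [hl, div_zero] at hγl
    exact hγl.not_gt hγ
  linarith [(lt_div_iff₀ hl).1 hγl]

theorem mul_lt_one_of_lt_one_div {γ mu L : ℝ} (hmu : 0 < mu) (hL : 0 ≤ L) (hγ : 0 < γ)
    (hγL : γ < 1 / (2 * mu + √3 * L)) : L * γ < 1 := by
  have hsqrt : 1 ≤ √3 := Real.one_le_sqrt.2 (by norm_num)
  have hL_le : L ≤ 2 * mu + √3 * L := by nlinarith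
  calc L * γ ≤ γ * (2 * mu + √3 * L) := by rw [mul_comm]; gcongr
    _ < 1 := (lt_div_iff₀ (by positivity)).1 hγL

theorem mainTheorem4_general {d : ℕ} {Ω S : Type*} [MeasurableSpace Ω] [MeasurableSpace S]
    (Pr : Measure Ω) [IsProbabilityMeasure Pr]
    (F : EuclideanSpace ℝ (Fin d) → EuclideanSpace ℝ (Fin d)) (hF : Measurable F)
    (lam mu : ℝ) (hmu : 0 < mu) (xs : EuclideanSpace ℝ (Fin d))
    (hmono : ∀ x, mu * ‖x - xs‖ ^ 2 - lam ≤ inner ℝ (F x) (x - xs))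
    (ξ : ℕ → Ω → S) (U : EuclideanSpace ℝ (Fin d) → S → EuclideanSpace ℝ (Fin d)) (σ : ℝ)
    (hnoise : HasSquareIntegrableNoise Pr ξ U σ) (hdens : HasPositiveDensityPart Pr ξ U) :
    (∀ l γ : ℝ, LinearGrowth F l → 0 < γ → γ * l ^ 2 < 2 * mu →
      RunsPositiveHarrisChain Pr ξ (sgda F U ξ γ)) ∧
    (∀ (L : ℝ≥0) (γ α : ℝ), LipschitzWith L F → 0 < γ → L * γ < 1 → 0 < α → α ≤ 1 →
      RunsPositiveHarrisChain Pr ξ (seg F U ξ γ α)) :=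
  ⟨fun _ _ hl hγ hγl => runsPositiveHarrisChain_sgda hF hmono hnoise hdens hl hγ hγl,
    fun _ _ _ hL hγ hLγ hα hα1 =>
      runsPositiveHarrisChain_seg hmu hmono hnoise hdens hL hγ hLγ hα hα1⟩

theorem mainTheorem4 {d : ℕ} {Ω S : Type*} [MeasurableSpace Ω] [MeasurableSpace S]
    (Pr : Measure Ω) [IsProbabilityMeasure Pr]
    (F : EuclideanSpace ℝ (Fin d) → EuclideanSpace ℝ (Fin d)) (hF : Measurable F)
    (lam mu : ℝ) (hlam : 0 ≤ lam) (hmu : 0 < mu)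
    (hmono : WeakQuasiStronglyMonotone F lam mu)
    (ξ : ℕ → Ω → S) (U : EuclideanSpace ℝ (Fin d) → S → EuclideanSpace ℝ (Fin d)) (σ : ℝ)
    (hnoise : IsNoise Pr ξ U σ) (hdens : HasPositiveDensityPart Pr ξ U) :
    (∀ l γ : ℝ, LinearGrowth F l → 0 < γ → γ < mu / l ^ 2 →
      ∃ (P : Kernel (EuclideanSpace ℝ (Fin d)) (EuclideanSpace ℝ (Fin d)))
        (_ : IsMarkovKernel P) (ψ : Measure (EuclideanSpace ℝ (Fin d))),
        (∀ X₀ : Ω → EuclideanSpace ℝ (Fin d), Measurable X₀ →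
          IndepFun X₀ (fun ω k => ξ k ω) Pr →
          IsMarkovChain Pr P (Pr.map X₀) (sgda F U ξ γ X₀)) ∧
        IsPsiIrreducible P ψ ∧ IsStronglyAperiodic P ∧
        IsHarrisRecurrent P ψ ∧ IsPositiveRecurrent P ψ ∧
        ∃ π : Measure (EuclideanSpace ℝ (Fin d)), IsProbabilityMeasure π ∧ P.Invariant π) ∧
    (∀ (L : ℝ≥0) (γ α : ℝ), LipschitzWith L F → 0 < γ → γ < 1 / (2 * mu + √3 * L) →
      0 < α → α < 1 →
      ∃ (P : Kernel (EuclideanSpace ℝ (Fin d)) (EuclideanSpace ℝ (Fin d)))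
        (_ : IsMarkovKernel P) (ψ : Measure (EuclideanSpace ℝ (Fin d))),
        (∀ X₀ : Ω → EuclideanSpace ℝ (Fin d), Measurable X₀ →
          IndepFun X₀ (fun ω k => ξ k ω) Pr →
          IsMarkovChain Pr P (Pr.map X₀) (seg F U ξ γ α X₀)) ∧
        IsPsiIrreducible P ψ ∧ IsStronglyAperiodic P ∧
        IsHarrisRecurrent P ψ ∧ IsPositiveRecurrent P ψ ∧
        ∃ π : Measure (EuclideanSpace ℝ (Fin d)), IsProbabilityMeasure π ∧ P.Invariant π) := by
  obtain ⟨xs, -, hmono⟩ := hmono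
  obtain ⟨hsgda, hseg⟩ := mainTheorem4_general Pr F hF lam mu hmu xs hmono ξ U σ
    hnoise.hasSquareIntegrableNoise hdens
  exact ⟨fun l γ hl hγ hγl => hsgda l γ hl hγ (mul_sq_lt_two_mul_of_lt_div_sq hmu hγ hγl),
    fun L γ α hL hγ hγL hα hα1 =>
      hseg L γ α hL hγ (mul_lt_one_of_lt_one_div hmu L.coe_nonneg hγ hγL) hα hα1.le⟩
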